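/- Let $p\ge 0$, $d\ge 0$ be integers and let $\mu$ be a Borel probability measure on $\mathbb{R}^p$ whose support $\operatorname{supp}\mu$ is compact with nonempty interior. Let $\Pi^p_d$ be the space of real polynomials in $p$ variables of degree at most $d$ and $s(d)=\binom{d+p}{d}$ its dimension. For a finite Borel measure $\nu$ with all moments, put $\langle P,Q\rangle_\nu=\int PQ\,d\nu$. If $\langle\cdot,\cdot\rangle_\nu$ is positive definite on $\Pi_d^p$ (as it is for $\nu=\mu$), let $\kappa_{\nu,d}$ be its reproducing kernel on $\Pi^p_d$ (the Christoffel--Darboux kernel), that is, $\kappa_{\nu,d}(x,\cdot)\in\Pi^p_d$ and $\int P(y)\kappa_{\nu,d}(x,y)\,d\nu(y)=P(x)$ for all $x\in\mathbb{R}^p$, $P\in\Pi^p_d$, and let $\Lambda_{\nu,d}(x)=1/\kappa_{\nu,d}(x,x)$ be the Christoffel function; if $\langle\cdot,\cdot\rangle_\nu$ is degenerate on $\Pi^p_d$, let $\Lambda_{\nu,d}(x)=\inf\{\int P^2\,d\nu : P\in\Pi^p_d,\ P(x)=1\}$ (a formula that also holds in the positive definite case). Let $n\ge 1$, let $X_1,\dots,X_n$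 be independent random vectors with law $\mu$, and let $\mu_n=\frac1n\sum_{i=1}^n\delta_{X_i}$. Then $$m=\sup_{x\in\operatorname{supp}\mu}\kappa_{\mu,d}(x,x)$$ is finite and, for every $\alpha>0$, there is an event of probability at least $1-\alpha$ on which, simultaneously for all $x\in\mathbb{R}^p$, $$\bigl|\Lambda_{\mu,d}(x)-\Lambda_{\mu_n,d}(x)\bigr|\le \Lambda_{\mu,d}(x)\,\max\left(\sqrt{\frac{16m}{3n}\log\frac{s(d)}{\alpha}},\ \frac{16m}{3n}\log\frac{s(d)}{\alpha}\right).$$ (For $\alpha\ge 1$ the assertion is void.) -/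

import Mathlib

open MeasureTheory ProbabilityTheory
open scoped ENNReal

/-- The space `Π_d^p` of real polynomials in `p` variables of total degree at most `d`. -/
noncomputable abbrev PolyLE (p d : ℕ) : Submodule ℝ (MvPolynomial (Fin p) ℝ) :=
  MvPolynomial.restrictTotalDegree (Fin p) ℝ d

/-- `K` is a reproducing kernel of `Π_d^p` with the inner product `⟨P, Q⟩ = ∫ P Q dμ`:
every `K x ·` is a polynomial of degree at most `d`, and `∫ P(y) K(x, y) dμ(y) = P(x)` for every
`x` and every `P` of degree at most `d`. -/
structure IsCDKernel {p : ℕ} (μ : Measure (Fin p → ℝ)) (d : ℕ)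
    (K : (Fin p → ℝ) → (Fin p → ℝ) → ℝ) : Prop where
  mem : ∀ x, ∃ Q ∈ PolyLE p d, ∀ y, K x y = MvPolynomial.eval y Q
  reproducing : ∀ x, ∀ P ∈ PolyLE p d,
    ∫ y, MvPolynomial.eval y P * K x y ∂μ = MvPolynomial.eval x P

/-- There is at most one reproducing kernel. -/
theorem IsCDKernel.unique {p : ℕ} {μ : Measure (Fin p → ℝ)} {d : ℕ}
    {K K' : (Fin p → ℝ) → (Fin p → ℝ) → ℝ} (h : IsCDKernel μ d K) (h' : IsCDKernel μ d K') :
    K = K' := by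
  have key : ∀ {K K' : (Fin p → ℝ) → (Fin p → ℝ) → ℝ}, IsCDKernel μ d K → IsCDKernel μ d K' →
      ∀ x y, K x y = K' y x := by
    intro K K' h h' x y
    obtain ⟨Q, hQ, hKQ⟩ := h.mem x
    obtain ⟨Q', hQ', hKQ'⟩ := h'.mem y
    have e1 := h'.reproducing y Q hQ
    have e2 := h.reproducing x Q' hQ'
    simp only [hKQ, hKQ'] at e1 e2 ⊢
    rw [← e1, ← e2]
    simp only [mul_comm]
  funext x y
  rw [key h h' x y, key h' h' y x]

open Classical in
/-- The Christoffel–Darboux kernel `κ_{μ,d}`: the reproducing kernel of `(Π_d^p, ⟨·,·⟩_μ)`.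
It exists exactly when the inner product is positive definite on `Π_d^p`;
the value `0` otherwise does not enter the Christoffel function. -/
noncomputable def cdKernel {p : ℕ} (μ : Measure (Fin p → ℝ)) (d : ℕ) :
    (Fin p → ℝ) → (Fin p → ℝ) → ℝ :=
  if h : ∃ K, IsCDKernel μ d K then h.choose else fun _ _ => 0

open Classical in
/-- The Christoffel function `Λ_{μ,d}(z) = 1 / κ_{μ,d}(z, z)`.  When `⟨·,·⟩_μ` is degenerate on
`Π_d^p`, so that there is no reproducing kernel (as for an empirical measure with too few sample
points), it is read through its variational form
`Λ_{μ,d}(z) = inf {∫ P² dμ : P ∈ Π_d^p, P(z) = 1}`; the two agree whenever the kernel exists,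
see `christoffel_eq_sInf`. -/
noncomputable def christoffel {p : ℕ} (μ : Measure (Fin p → ℝ)) (d : ℕ) (z : Fin p → ℝ) : ℝ :=
  if ∃ K, IsCDKernel μ d K then 1 / cdKernel μ d z z
  else sInf {r : ℝ | ∃ P ∈ PolyLE p d, MvPolynomial.eval z P = 1 ∧
    r = ∫ y, (MvPolynomial.eval y P) ^ 2 ∂μ}

/-- The empirical measure `(1/n) ∑ᵢ δ_{xᵢ}` of the points `x₁, …, xₙ`. -/
noncomputable def empiricalMeasure {p n : ℕ} (x : Fin n → Fin p → ℝ) : Measure (Fin p → ℝ) :=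
  (n : ℝ≥0∞)⁻¹ • ∑ i, Measure.dirac (x i)

theorem isCDKernel_cdKernel {p : ℕ} {μ : Measure (Fin p → ℝ)} {d : ℕ}
    (h : ∃ K, IsCDKernel μ d K) : IsCDKernel μ d (cdKernel μ d) := by
  rw [cdKernel, dif_pos h]
  exact h.choose_spec

/-- When polynomials are integrable and the kernel exists, the two formulas for the Christoffel
function agree. -/
theorem christoffel_eq_sInf {p : ℕ} {μ : Measure (Fin p → ℝ)} {d : ℕ}
    (hint : ∀ P : MvPolynomial (Fin p) ℝ, Integrable (fun y => MvPolynomial.eval y P) μ)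
    (h : ∃ K, IsCDKernel μ d K) (z : Fin p → ℝ) :
    christoffel μ d z = sInf {r : ℝ | ∃ P ∈ PolyLE p d, MvPolynomial.eval z P = 1 ∧
      r = ∫ y, (MvPolynomial.eval y P) ^ 2 ∂μ} := by
  rw [christoffel, if_pos h]
  have hK := isCDKernel_cdKernel h
  obtain ⟨Q, hQ, hKQ⟩ := hK.mem z
  set k := cdKernel μ d z z with hk
  have hQz : MvPolynomial.eval z Q = k := (hKQ z).symm
  have hrep : ∀ P ∈ PolyLE p d,
      ∫ y, MvPolynomial.eval y P * MvPolynomial.eval y Q ∂μ = MvPolynomial.eval z P := by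
    intro P hP
    have := hK.reproducing z P hP
    simpa only [hKQ] using this
  have hone : (1 : MvPolynomial (Fin p) ℝ) ∈ PolyLE p d := by
    rw [MvPolynomial.mem_restrictTotalDegree]; simp
  -- the key lower bound
  have hlow : ∀ P ∈ PolyLE p d, ∀ t : ℝ,
      0 ≤ ∫ y, (MvPolynomial.eval y P) ^ 2 ∂μ - 2 * t * MvPolynomial.eval z P + t ^ 2 * k := by
    intro P hP t
    have h0 : 0 ≤ ∫ y, (MvPolynomial.eval y (P - MvPolynomial.C t * Q)) ^ 2 ∂μ :=
      integral_nonneg fun y => sq_nonneg _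
    have i1 : Integrable (fun y => (MvPolynomial.eval y P) ^ 2) μ := by
      exact (hint (P ^ 2)).congr (ae_of_all _ fun y => by simp only [map_pow])
    have i2 : Integrable (fun y => 2 * t * (MvPolynomial.eval y P * MvPolynomial.eval y Q)) μ := by
      have := (hint (P * Q)).const_mul (2 * t)
      simpa using this
    have i3 : Integrable (fun y => t ^ 2 * (MvPolynomial.eval y Q * MvPolynomial.eval y Q)) μ := by
      have := (hint (Q * Q)).const_mul (t ^ 2)
      simpa using this
    have e : ∀ y, (MvPolynomial.eval y (P - MvPolynomial.C t * Q)) ^ 2 =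
        (MvPolynomial.eval y P) ^ 2 - 2 * t * (MvPolynomial.eval y P * MvPolynomial.eval y Q)
          + t ^ 2 * (MvPolynomial.eval y Q * MvPolynomial.eval y Q) := by
      intro y; simp; ring
    simp only [e] at h0
    rw [integral_add (f := fun y => (MvPolynomial.eval y P) ^ 2 -
        2 * t * (MvPolynomial.eval y P * MvPolynomial.eval y Q)) (i1.sub i2) i3,
      integral_sub i1 i2, integral_const_mul, integral_const_mul,
      hrep P hP, hrep Q hQ, hQz] at h0
    exact h0
  have hk0 : 0 < k := by
    have hnn : 0 ≤ k := by
      have := hrep Q hQ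
      rw [hQz] at this
      rw [← this]
      exact integral_nonneg fun y => mul_self_nonneg _
    rcases hnn.lt_or_eq with h | h
    · exact h
    · exfalso
      have := hlow 1 hone ((∫ y, (MvPolynomial.eval y (1 : MvPolynomial (Fin p) ℝ)) ^ 2 ∂μ) + 1)
      rw [← h] at this
      have h1 : 0 ≤ ∫ y, (MvPolynomial.eval y (1 : MvPolynomial (Fin p) ℝ)) ^ 2 ∂μ :=
        integral_nonneg fun y => sq_nonneg _
      simp only [map_one] at this h1
      linarith
  symm
  apply IsLeast.csInf_eq
  constructor
  · refine ⟨MvPolynomial.C (1 / k) * Q, ?_, ?_, ?_⟩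
    · have := (PolyLE p d).smul_mem (1 / k) hQ
      rwa [MvPolynomial.smul_eq_C_mul] at this
    · simp [hQz, hk0.ne']
    · have e : ∀ y, (MvPolynomial.eval y (MvPolynomial.C (1 / k) * Q)) ^ 2 =
          (1 / k) ^ 2 * (MvPolynomial.eval y Q * MvPolynomial.eval y Q) := by
        intro y; simp; ring
      simp only [e]
      rw [integral_const_mul, hrep Q hQ, hQz]
      field_simp
  · rintro r ⟨P, hP, hPz, rfl⟩
    have := hlow P hP (1 / k)
    rw [hPz] at this
    have e : (1 / k) ^ 2 * k = 1 / k := by field_simp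
    rw [e] at this
    linarith

/-- The kernel exists for every probability measure with compact support of nonempty interior. -/
theorem exists_isCDKernel {p : ℕ} {μ : Measure (Fin p → ℝ)} [IsProbabilityMeasure μ] (d : ℕ)
    (hcomp : IsCompact μ.support) (hint : (interior μ.support).Nonempty) :
    ∃ K, IsCDKernel μ d K := by
  have hae : ∀ᵐ x ∂μ, x ∈ μ.support := Measure.support_mem_ae
  have hI : ∀ P : MvPolynomial (Fin p) ℝ, Integrable (fun y => MvPolynomial.eval y P) μ := by
    intro P
    have hc : Continuous fun y : Fin p → ℝ => MvPolynomial.eval y P := MvPolynomial.continuous_eval P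
    obtain ⟨C, hC⟩ := (hcomp.image hc).isBounded.exists_norm_le
    refine Integrable.of_bound hc.aestronglyMeasurable C ?_
    filter_upwards [hae] with x hx
    exact hC _ ⟨x, hx, rfl⟩
  have hdef : ∀ P : MvPolynomial (Fin p) ℝ,
      ∫ y, MvPolynomial.eval y P * MvPolynomial.eval y P ∂μ = 0 → P = 0 := by
    intro P hP
    have hc : Continuous fun y : Fin p → ℝ => MvPolynomial.eval y P := MvPolynomial.continuous_eval P
    rw [integral_eq_zero_iff_of_nonneg (fun y => mul_self_nonneg _)
      (by simpa using hI (P * P))] at hP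
    have hz : ∀ x ∈ μ.support, MvPolynomial.eval x P = 0 := by
      intro x hx
      by_contra hne
      have hopen : IsOpen {y : Fin p → ℝ | MvPolynomial.eval y P ≠ 0} :=
        isOpen_ne_fun hc continuous_const
      have hpos := (Measure.mem_support_iff_forall x).1 hx _ (hopen.mem_nhds hne)
      refine hpos.ne' (measure_mono_null ?_ (ae_iff.1 hP))
      intro y hy
      simpa using hy
    obtain ⟨x, hx⟩ := hint
    obtain ⟨ε, hε, hball⟩ := Metric.isOpen_iff.1 isOpen_interior x hx
    refine MvPolynomial.funext_set (fun i => Metric.ball (x i) ε) (fun i => ?_) ?_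
    · rw [Real.ball_eq_Ioo]
      exact Set.Ioo_infinite (by linarith)
    · intro y hy
      rw [map_zero]
      refine hz y (interior_subset (hball ?_))
      rw [ball_pi _ hε]
      exact hy
  let B : PolyLE p d →ₗ[ℝ] Module.Dual ℝ (PolyLE p d) :=
    LinearMap.mk₂ ℝ (fun Q P => ∫ y, MvPolynomial.eval y P.1 * MvPolynomial.eval y Q.1 ∂μ)
      (by
        intro Q Q' P
        rw [← integral_add (by simpa using hI (P.1 * Q.1)) (by simpa using hI (P.1 * Q'.1))]
        simp [mul_add])
      (by
        intro c Q P
        rw [smul_eq_mul, ← integral_const_mul]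
        congr 1; funext y; simp; ring)
      (by
        intro Q P P'
        rw [← integral_add (by simpa using hI (P.1 * Q.1)) (by simpa using hI (P'.1 * Q.1))]
        simp [add_mul])
      (by
        intro c Q P
        rw [smul_eq_mul, ← integral_const_mul]
        congr 1; funext y; simp; ring)
  have hinj : Function.Injective B := by
    rw [injective_iff_map_eq_zero]
    intro Q hQ
    have : B Q Q = 0 := by rw [hQ]; rfl
    exact Subtype.ext (hdef Q.1 this)
  have hsurj : Function.Surjective B :=
    (LinearMap.injective_iff_surjective_of_finrank_eq_finrank
      Subspace.dual_finrank_eq.symm).1 hinj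
  have hx : ∀ x : Fin p → ℝ, ∃ Q : PolyLE p d, ∀ P : PolyLE p d,
      ∫ y, MvPolynomial.eval y P.1 * MvPolynomial.eval y Q.1 ∂μ = MvPolynomial.eval x P.1 := by
    intro x
    obtain ⟨Q, hQ⟩ := hsurj ((MvPolynomial.aeval x).toLinearMap ∘ₗ (PolyLE p d).subtype)
    refine ⟨Q, fun P => ?_⟩
    have := LinearMap.congr_fun hQ P
    simpa [B, MvPolynomial.aeval_eq_eval] using this
  choose Q hQ using hx
  exact ⟨fun x y => MvPolynomial.eval y (Q x).1, fun x => ⟨(Q x).1, (Q x).2, fun y => rfl⟩,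
    fun x P hP => hQ x ⟨P, hP⟩⟩

/-! Let v(x) be the vector of values at x of an orthonormal basis of Π_d^p. Then κ(x,x) = |v(x)|² ≤
m on the support, and v vᵀ has mean 1 under μ. A polynomial P with coefficient vector q has ∫ P² dμ
= |q|², while its empirical counterpart is the quadratic form of (1/n) ∑ v(X_i) v(X_i)ᵀ at q. A
matrix Chernoff bound (`IsBoundedIsotropic.measure_abs_sum_sq_sub_gt_le`) makes the two forms
relatively close for all q at once. Since Λ(x) is an infimum of such forms, the relative error
passes to Λ at every x, on or off the support (`abs_christoffel_sub_le`).

The Chernoff bound rests on the one-step estimate `Matrix.SpectrumIcc.trace_exp_add_le`, obtained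
here without Golden–Thompson or Lieb. For 0 ≤ X ≤ M the function φ(s) = tr exp(A + sX) satisfies φ''
≤ M φ', and integrating this twice produces the factor (e^M - 1)/M. The proof runs a discrete
version: X is cut into N equal pieces, each increment is controlled by a scalar inequality in two
variables applied to pairs of eigenvalues (`Matrix.IsHermitian.trace_exp_nonneg_of_forall`), and N
tends to infinity. With X = v vᵀ, averaging multiplies tr exp H by at most 1 + c ≤ e^c; the
independent summands are peeled off one at a time, and Markov's inequality with a suitable parameter
gives the tails. -/

/-! ### Trace inequalities for exponentials of real symmetric matrices -/

open Matrix in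
/-- Real symmetric matrices are orthogonally diagonalizable, compatibly with the exponential. -/
theorem Matrix.IsHermitian.exists_orthogonal_diagonalization {ι : Type*} [Fintype ι]
    [DecidableEq ι] {A : Matrix ι ι ℝ} (hA : A.IsHermitian) :
    ∃ (U : Matrix ι ι ℝ) (a : ι → ℝ), Uᵀ * U = 1 ∧ U * Uᵀ = 1 ∧ A = U * diagonal a * Uᵀ ∧
      NormedSpace.exp A = U * diagonal (fun i => Real.exp (a i)) * Uᵀ := by
  set U : Matrix ι ι ℝ := (hA.eigenvectorUnitary : Matrix ι ι ℝ) with hU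
  have h1 : Uᵀ * U = 1 := by
    have := Unitary.coe_star_mul_self hA.eigenvectorUnitary
    simpa [star_eq_conjTranspose] using this
  have h2 : U * Uᵀ = 1 := by
    have := Unitary.coe_mul_star_self hA.eigenvectorUnitary
    simpa [star_eq_conjTranspose] using this
  have h3 : A = U * diagonal hA.eigenvalues * Uᵀ := by
    have := hA.spectral_theorem
    rw [Unitary.conjStarAlgAut_apply] at this
    simpa [star_eq_conjTranspose, Function.comp_def] using this
  refine ⟨U, hA.eigenvalues, h1, h2, h3, ?_⟩
  have hinv : U⁻¹ = Uᵀ := Matrix.inv_eq_left_inv h1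
  conv_lhs => rw [h3, ← hinv]
  rw [Matrix.exp_conj _ _ (IsUnit.of_mul_eq_one _ h2), Matrix.exp_diagonal, hinv]
  congr 3
  funext i
  simp [Pi.coe_exp, Real.exp_eq_exp_ℝ]

-- For orthogonal U and W the entries of Uᵀ W are the inner products of the two eigenbases. Their
-- squares are nonnegative weights common to all pairs of functions f, g, which is what lets scalar
-- inequalities pass to traces.
open Matrix in
theorem Matrix.trace_mul_orthogonal_diagonal {ι : Type*} [Fintype ι] [DecidableEq ι]
    (U W : Matrix ι ι ℝ) (f g : ι → ℝ) :
    trace ((U * diagonal f * Uᵀ) * (W * diagonal g * Wᵀ)) =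
      ∑ j, ∑ k, f j * g k * ((Uᵀ * W) j k) ^ 2 := by
  have : trace ((U * diagonal f * Uᵀ) * (W * diagonal g * Wᵀ)) =
      trace ((diagonal f * (Uᵀ * W)) * (diagonal g * (Uᵀ * W)ᵀ)) := by
    rw [show (U * diagonal f * Uᵀ) * (W * diagonal g * Wᵀ) =
      U * (diagonal f * Uᵀ * W * diagonal g * Wᵀ) by simp only [Matrix.mul_assoc], trace_mul_comm]
    simp only [Matrix.mul_assoc, transpose_mul, transpose_transpose]
  rw [this, trace]
  refine Finset.sum_congr rfl fun j _ => ?_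
  rw [diag_apply, mul_apply]
  refine Finset.sum_congr rfl fun k _ => ?_
  rw [diagonal_mul, diagonal_mul, transpose_apply]
  ring

open Matrix in
theorem Matrix.orthogonal_diagonal_mul {ι : Type*} [Fintype ι] [DecidableEq ι]
    {U : Matrix ι ι ℝ} (hU : Uᵀ * U = 1) (f g : ι → ℝ) :
    (U * diagonal f * Uᵀ) * (U * diagonal g * Uᵀ) =
      U * diagonal (fun i => f i * g i) * Uᵀ := by
  calc (U * diagonal f * Uᵀ) * (U * diagonal g * Uᵀ)
      = U * diagonal f * (Uᵀ * U) * diagonal g * Uᵀ := by simp only [Matrix.mul_assoc]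
    _ = _ := by rw [hU, Matrix.mul_one, Matrix.mul_assoc U, diagonal_mul_diagonal]

open Matrix in
/-- A two-variable scalar inequality transfers to traces of functions of two real symmetric
matrices. -/
theorem Matrix.IsHermitian.trace_exp_nonneg_of_forall {ι : Type*} [Fintype ι] [DecidableEq ι]
    {A B : Matrix ι ι ℝ} (hA : A.IsHermitian) (hB : B.IsHermitian) (c₀ c₁ c₂ c₃ c₄ c₅ : ℝ)
    (hc : ∀ s t : ℝ, 0 ≤ c₀ * Real.exp s + c₁ * Real.exp t +
      c₂ * ((t - s) * Real.exp s) + c₃ * ((t - s) * Real.exp t) +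
      c₄ * ((t - s) ^ 2 * Real.exp s) + c₅ * ((t - s) ^ 2 * Real.exp t)) :
    0 ≤ c₀ * trace (NormedSpace.exp A) + c₁ * trace (NormedSpace.exp B) +
      c₂ * trace ((B - A) * NormedSpace.exp A) + c₃ * trace ((B - A) * NormedSpace.exp B) +
      c₄ * trace ((B - A) * (B - A) * NormedSpace.exp A) +
      c₅ * trace ((B - A) * (B - A) * NormedSpace.exp B) := by
  obtain ⟨U, a, hU, hU', hAU, heA⟩ := hA.exists_orthogonal_diagonalization
  obtain ⟨W, b, hW, hW', hBW, heB⟩ := hB.exists_orthogonal_diagonalization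
  have hsum : 0 ≤ ∑ j, ∑ k, (c₀ * Real.exp (a j) + c₁ * Real.exp (b k) +
      c₂ * ((b k - a j) * Real.exp (a j)) + c₃ * ((b k - a j) * Real.exp (b k)) +
      c₄ * ((b k - a j) ^ 2 * Real.exp (a j)) + c₅ * ((b k - a j) ^ 2 * Real.exp (b k))) *
        ((Uᵀ * W) j k) ^ 2 :=
    Finset.sum_nonneg fun j _ => Finset.sum_nonneg fun k _ => mul_nonneg (hc _ _) (sq_nonneg _)
  refine hsum.trans_eq ?_
  clear hsum hc
  have comA : A * NormedSpace.exp A = NormedSpace.exp A * A := by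
    rw [heA, hAU, orthogonal_diagonal_mul hU, orthogonal_diagonal_mul hU]
    simp only [mul_comm]
  have comB : B * NormedSpace.exp B = NormedSpace.exp B * B := by
    rw [heB, hBW, orthogonal_diagonal_mul hW, orthogonal_diagonal_mul hW]
    simp only [mul_comm]
  -- Writing 1 as the constant function of either matrix turns traces that involve only one of `A`,
  -- `B` into the same double sums.
  have oneU : U * diagonal (fun _ => (1 : ℝ)) * Uᵀ = 1 := by simp [hU']
  have oneW : W * diagonal (fun _ => (1 : ℝ)) * Wᵀ = 1 := by simp [hW']
  have T := trace_mul_orthogonal_diagonal U W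
  have eA := T (fun j => Real.exp (a j)) (fun _ => 1)
  have eB := T (fun _ => 1) (fun k => Real.exp (b k))
  have AeA := T (fun j => a j * Real.exp (a j)) (fun _ => 1)
  have BeA := T (fun j => Real.exp (a j)) b
  have AeB := T a (fun k => Real.exp (b k))
  have BeB := T (fun _ => 1) (fun k => b k * Real.exp (b k))
  have AAeA := T (fun j => a j * (a j * Real.exp (a j))) (fun _ => 1)
  have ABeA := T (fun j => a j * Real.exp (a j)) b
  have BBeA := T (fun j => Real.exp (a j)) (fun k => b k * b k)
  have AAeB := T (fun j => a j * a j) (fun k => Real.exp (b k))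
  have ABeB := T a (fun k => b k * Real.exp (b k))
  have BBeB := T (fun _ => 1) (fun k => b k * (b k * Real.exp (b k)))
  simp only [← orthogonal_diagonal_mul hU, ← orthogonal_diagonal_mul hW, oneU, oneW,
    ← hAU, ← hBW, ← heA, ← heB, Matrix.mul_one, Matrix.one_mul] at *
  -- Cyclicity of the trace, and commutation of a matrix with its own exponential, bring every mixed
  -- term to the form tr(f(A) g(B)).
  have c1 : trace (B * NormedSpace.exp A) = trace (NormedSpace.exp A * B) := trace_mul_comm _ _
  have c2 : trace (A * B * NormedSpace.exp A) = trace (A * NormedSpace.exp A * B) := by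
    rw [comA, Matrix.mul_assoc, trace_mul_comm, Matrix.mul_assoc, trace_mul_comm]
  have c3 : trace (B * A * NormedSpace.exp A) = trace (A * NormedSpace.exp A * B) := by
    rw [Matrix.mul_assoc, trace_mul_comm]
  have c4 : trace (B * B * NormedSpace.exp A) = trace (NormedSpace.exp A * (B * B)) :=
    trace_mul_comm _ _
  have c5 : trace (B * A * NormedSpace.exp B) = trace (A * (B * NormedSpace.exp B)) := by
    rw [Matrix.mul_assoc, trace_mul_comm, Matrix.mul_assoc, comB]
  simp only [Matrix.sub_mul, Matrix.mul_sub, trace_sub, c1, c2, c3, c4, c5]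
  simp only [Matrix.mul_assoc] at *
  simp only [eA, eB, AeA, BeA, AeB, BeB, AAeA, ABeA, BBeA, AAeB, ABeB, BBeB, Finset.mul_sum,
    ← Finset.sum_sub_distrib, ← Finset.sum_add_distrib]
  refine Finset.sum_congr rfl fun j _ => Finset.sum_congr rfl fun k _ => ?_
  ring

/-- The logarithmic mean is at most the arithmetic mean. -/
theorem mul_exp_sub_one_le (x : ℝ) : x * (Real.exp x - 1) ≤ x ^ 2 / 2 * (Real.exp x + 1) := by
  have key : ∀ y : ℝ, 0 ≤ y → 2 * (Real.exp y - 1) ≤ y * (Real.exp y + 1) := by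
    intro y hy
    have hd : ∀ t : ℝ, HasDerivAt (fun t => t * (Real.exp t + 1) - 2 * (Real.exp t - 1))
        (t * Real.exp t - Real.exp t + 1) t := by
      intro t
      have h := ((hasDerivAt_id t).mul ((Real.hasDerivAt_exp t).add_const 1)).sub
        (((Real.hasDerivAt_exp t).sub_const 1).const_mul 2)
      refine h.congr_deriv ?_
      simp only [id]; ring
    have hm : Monotone (fun t : ℝ => t * (Real.exp t + 1) - 2 * (Real.exp t - 1)) := by
      refine monotone_of_deriv_nonneg (fun t => (hd t).differentiableAt) fun t => ?_
      rw [(hd t).deriv]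
      have h1 := Real.add_one_le_exp (-t)
      have h2 : Real.exp (-t) * Real.exp t = 1 := by rw [← Real.exp_add]; simp
      nlinarith [Real.exp_pos t]
    have := hm hy
    simp only [Real.exp_zero] at this
    linarith
  rcases le_total 0 x with hx | hx
  · nlinarith [key x hx]
  · have h1 := key (-x) (by linarith)
    have h2 : Real.exp (-x) * Real.exp x = 1 := by rw [← Real.exp_add]; simp
    have h3 : 2 * (1 - Real.exp x) ≤ -x * (1 + Real.exp x) := by
      have := mul_le_mul_of_nonneg_right h1 (Real.exp_pos x).le
      nlinarith
    nlinarith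

open Matrix in
theorem Matrix.IsHermitian.exp_posSemidef {ι : Type*} [Fintype ι] [DecidableEq ι]
    {A : Matrix ι ι ℝ} (hA : A.IsHermitian) : (NormedSpace.exp A).PosSemidef := by
  obtain ⟨U, a, hU, -, -, h⟩ := hA.exists_orthogonal_diagonalization
  rw [h]
  have := (PosSemidef.diagonal (d := fun i => Real.exp (a i))
    (fun i => (Real.exp_pos _).le)).mul_mul_conjTranspose_same U
  simpa using this

/-! ### The one-step trace bound -/

open Matrix in
/-- `X` behaves in trace inequalities like a symmetric matrix with spectrum in `[0, M]`. -/
structure Matrix.SpectrumIcc {ι : Type*} [Fintype ι] [DecidableEq ι]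
    (X : Matrix ι ι ℝ) (M : ℝ) : Prop where
  isHermitian : X.IsHermitian
  trace_nonneg : ∀ C : Matrix ι ι ℝ, C.IsHermitian → 0 ≤ trace (X * NormedSpace.exp C)
  trace_sq_le : ∀ C : Matrix ι ι ℝ, C.IsHermitian →
    trace (X * X * NormedSpace.exp C) ≤ M * trace (X * NormedSpace.exp C)

open Matrix in
theorem Matrix.SpectrumIcc.smul {ι : Type*} [Fintype ι] [DecidableEq ι]
    {X : Matrix ι ι ℝ} {M : ℝ} (hX : X.SpectrumIcc M) {t : ℝ} (ht : 0 ≤ t) :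
    (t • X).SpectrumIcc (t * M) where
  isHermitian := by
    have := hX.isHermitian
    unfold IsHermitian at *
    rw [conjTranspose_smul, this, star_trivial]
  trace_nonneg C hC := by
    rw [Matrix.smul_mul, trace_smul]
    exact mul_nonneg ht (hX.trace_nonneg C hC)
  trace_sq_le C hC := by
    have := hX.trace_sq_le C hC
    simp only [Matrix.smul_mul, Matrix.mul_smul, trace_smul, smul_eq_mul]
    have h2 := mul_le_mul_of_nonneg_left this (mul_nonneg ht ht)
    nlinarith

open Matrix in
theorem Matrix.dotProduct_exp_mulVec_nonneg {ι : Type*} [Fintype ι] [DecidableEq ι]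
    {C : Matrix ι ι ℝ} (hC : C.IsHermitian) (v : ι → ℝ) :
    0 ≤ v ⬝ᵥ (NormedSpace.exp C *ᵥ v) := by
  simpa using hC.exp_posSemidef.dotProduct_mulVec_nonneg v

-- The square of v vᵀ is |v|² v vᵀ, so the second trace condition reduces to the bound on |v|².
open Matrix in
theorem Matrix.SpectrumIcc.vecMulVec {ι : Type*} [Fintype ι] [DecidableEq ι]
    {v : ι → ℝ} {M : ℝ} (hv : v ⬝ᵥ v ≤ M) : (vecMulVec v v).SpectrumIcc M := by
  have ht : ∀ C : Matrix ι ι ℝ, trace (Matrix.vecMulVec v v * C) = v ⬝ᵥ (C *ᵥ v) := by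
    intro C
    rw [vecMulVec_mul, trace_vecMulVec, dotProduct_mulVec, dotProduct_comm]
  refine ⟨?_, fun C hC => ?_, fun C hC => ?_⟩
  · simpa using (posSemidef_vecMulVec_self_star v).isHermitian
  · rw [ht]; exact dotProduct_exp_mulVec_nonneg hC v
  · have : Matrix.vecMulVec v v * Matrix.vecMulVec v v = (v ⬝ᵥ v) • Matrix.vecMulVec v v := by
      rw [vecMulVec_mul_vecMulVec, vecMulVec_smul]
    rw [this, Matrix.smul_mul, trace_smul, smul_eq_mul, ht]
    exact mul_le_mul_of_nonneg_right hv (dotProduct_exp_mulVec_nonneg hC v)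

-- Expanding (M - X)² and using the trace form of X² ≤ M X gives the second condition. Positivity
-- then follows from it, because the trace of a square against exp C is nonnegative and M > 0.
open Matrix in
theorem Matrix.SpectrumIcc.sub {ι : Type*} [Fintype ι] [DecidableEq ι]
    {X : Matrix ι ι ℝ} {M : ℝ} (hM : 0 < M) (hX : X.SpectrumIcc M) :
    (M • (1 : Matrix ι ι ℝ) - X).SpectrumIcc M := by
  have hH : (M • (1 : Matrix ι ι ℝ) - X).IsHermitian := by
    have := hX.isHermitian
    unfold IsHermitian at *
    rw [conjTranspose_sub, conjTranspose_smul, this, conjTranspose_one, star_trivial]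
  have hsq : ∀ C : Matrix ι ι ℝ, C.IsHermitian →
      trace ((M • (1 : Matrix ι ι ℝ) - X) * (M • (1 : Matrix ι ι ℝ) - X) * NormedSpace.exp C) ≤
        M * trace ((M • (1 : Matrix ι ι ℝ) - X) * NormedSpace.exp C) := by
    intro C hC
    have := hX.trace_sq_le C hC
    simp only [Matrix.sub_mul, Matrix.mul_sub, Matrix.smul_mul, Matrix.mul_smul, trace_smul, trace_sub,
      Matrix.one_mul, Matrix.mul_one, smul_eq_mul]
    linarith
  refine ⟨hH, fun C hC => ?_, hsq⟩
  have h0 : 0 ≤ trace ((M • (1 : Matrix ι ι ℝ) - X) * (M • (1 : Matrix ι ι ℝ) - X) *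
      NormedSpace.exp C) := by
    have h := (hC.exp_posSemidef.mul_mul_conjTranspose_same
      (M • (1 : Matrix ι ι ℝ) - X)).trace_nonneg
    rw [hH.eq, Matrix.mul_assoc, trace_mul_comm, Matrix.mul_assoc, trace_mul_comm] at h
    exact h
  exact nonneg_of_mul_nonneg_right (h0.trans (hsq C hC)) hM

-- Discrete form of φ'' ≤ M φ': the logarithmic-arithmetic mean inequality at the eigenvalues of A
-- and A + X bounds the increment of tr(X exp ·) by the average of tr(X² exp ·) at the two ends, and
-- X² ≤ M X absorbs the square.
open Matrix in
theorem Matrix.SpectrumIcc.trace_mul_exp_add_le {ι : Type*} [Fintype ι] [DecidableEq ι]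
    {A X : Matrix ι ι ℝ} {M : ℝ} (hA : A.IsHermitian) (hX : X.SpectrumIcc M) :
    (1 - M / 2) * trace (X * NormedSpace.exp (A + X)) ≤
      (1 + M / 2) * trace (X * NormedSpace.exp A) := by
  have hB := hA.add hX.isHermitian
  have h1 := hX.trace_sq_le _ hA
  have h2 := hX.trace_sq_le _ hB
  have hle := hA.trace_exp_nonneg_of_forall hB 0 0 1 (-1) (1 / 2) (1 / 2) fun s t => by
    have h3 := mul_le_mul_of_nonneg_right (mul_exp_sub_one_le (t - s)) (Real.exp_pos s).le
    have h4 : Real.exp t = Real.exp (t - s) * Real.exp s := by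
      rw [← Real.exp_add]; ring_nf
    rw [h4]
    linarith
  rw [add_sub_cancel_left] at hle
  linarith

open Matrix in
/-- Klein's inequality for the exponential. -/
theorem Matrix.IsHermitian.trace_exp_add_le {ι : Type*} [Fintype ι] [DecidableEq ι]
    {A X : Matrix ι ι ℝ} (hA : A.IsHermitian) (hX : X.IsHermitian) :
    trace (NormedSpace.exp (A + X)) ≤ trace (NormedSpace.exp A) +
      trace (X * NormedSpace.exp (A + X)) := by
  have hle := hA.trace_exp_nonneg_of_forall (hA.add hX) 1 (-1) 0 1 0 0 fun s t => by
    have h3 := mul_le_mul_of_nonneg_right (Real.add_one_le_exp (s - t)) (Real.exp_pos t).le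
    have h4 : Real.exp s = Real.exp (s - t) * Real.exp t := by
      rw [← Real.exp_add]; ring_nf
    rw [h4]
    linarith
  rw [add_sub_cancel_left] at hle
  linarith

-- Euler scheme with N steps Y = X/N: tr(Y exp ·) grows by a factor of at most r per step, and
-- Klein's inequality sums these values into a geometric series.
open Matrix in
theorem Matrix.SpectrumIcc.trace_exp_add_le_of_nat {ι : Type*} [Fintype ι] [DecidableEq ι]
    {A X : Matrix ι ι ℝ} {M : ℝ} (hM : 0 < M) (hA : A.IsHermitian) (hX : X.SpectrumIcc M)
    (N : ℕ) (hN : 0 < N) (hMN : M / N < 2) :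
    trace (NormedSpace.exp (A + X)) ≤ trace (NormedSpace.exp A) +
      (1 + M / N / 2) * ((Real.exp (M / (1 - M / N / 2)) - 1) / M) *
        trace (X * NormedSpace.exp A) := by
  have hN' : (0 : ℝ) < N := by exact_mod_cast hN
  set z : ℝ := M / N with hz
  have hz0 : 0 < z := by positivity
  have hNz : N * z = M := by rw [hz]; field_simp
  have hd : 0 < 1 - z / 2 := by linarith
  have hd' : 2 - z ≠ 0 := by linarith
  set r : ℝ := (1 + z / 2) / (1 - z / 2) with hr
  have hr0 : 0 < r := by positivity
  set Y : Matrix ι ι ℝ := (1 / (N : ℝ)) • X with hY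
  have hYz : Y.SpectrumIcc z := by
    have := hX.smul (t := 1 / (N : ℝ)) (by positivity)
    rwa [one_div_mul_eq_div] at this
  have hAj : ∀ j : ℕ, (A + (j : ℝ) • Y).IsHermitian := fun j =>
    hA.add (hYz.smul (t := (j : ℝ)) (by positivity)).isHermitian
  have hstep : ∀ j : ℕ, A + ((j + 1 : ℕ) : ℝ) • Y = A + (j : ℝ) • Y + Y := fun j => by
    push_cast; rw [add_smul, one_smul, add_assoc]
  set ψ : ℝ := trace (Y * NormedSpace.exp A) with hψ
  have hψ0 : 0 ≤ ψ := hYz.trace_nonneg A hA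
  have h1 : ∀ j : ℕ, trace (Y * NormedSpace.exp (A + (j : ℝ) • Y)) ≤ r ^ j * ψ := by
    intro j
    induction j with
    | zero => simp [hψ]
    | succ j ih =>
      rw [hstep]
      have h := hYz.trace_mul_exp_add_le (hAj j)
      have h' : trace (Y * NormedSpace.exp (A + (j : ℝ) • Y + Y)) ≤
          r * trace (Y * NormedSpace.exp (A + (j : ℝ) • Y)) := by
        rw [hr, div_mul_eq_mul_div, le_div_iff₀ hd]
        linarith
      calc _ ≤ _ := h'
        _ ≤ r * (r ^ j * ψ) := by gcongr
        _ = _ := by ring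
  have h2 : ∀ j : ℕ, trace (NormedSpace.exp (A + (j : ℝ) • Y)) ≤ trace (NormedSpace.exp A) +
      (r ^ j - 1) * ((1 + z / 2) / z) * ψ := by
    intro j
    induction j with
    | zero => simp
    | succ j ih =>
      have h := (hAj j).trace_exp_add_le hYz.isHermitian
      rw [← hstep] at h
      have e : (r ^ (j + 1) - 1) * ((1 + z / 2) / z) * ψ =
          (r ^ j - 1) * ((1 + z / 2) / z) * ψ + r ^ (j + 1) * ψ := by
        -- The coefficient is r/(r - 1), from r + r² + ⋯ + r^j = (r^j - 1) r/(r - 1).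
        have : (r - 1) * ((1 + z / 2) / z) = r := by
          rw [hr]; field_simp; ring
        linear_combination r ^ j * ψ * this
      linarith [h1 (j + 1)]
  have h3 : r ^ N ≤ Real.exp (M / (1 - z / 2)) := by
    have : r ≤ Real.exp (z / (1 - z / 2)) := by
      have h := Real.add_one_le_exp (z / (1 - z / 2))
      have e : r = z / (1 - z / 2) + 1 := by rw [hr]; field_simp; ring
      rwa [e]
    calc r ^ N ≤ Real.exp (z / (1 - z / 2)) ^ N := by gcongr
      _ = _ := by rw [← Real.exp_nat_mul, ← hNz]; ring_nf
  have hX' : X = (N : ℝ) • Y := by rw [hY, smul_smul]; field_simp; simp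
  have h4 := h2 N
  rw [← hX'] at h4
  have h5 : trace (X * NormedSpace.exp A) = N * ψ := by
    rw [hψ, hX', Matrix.smul_mul, trace_smul, smul_eq_mul]
  rw [h5]
  refine h4.trans ?_
  have h6 : (r ^ N - 1) * ((1 + z / 2) / z) * ψ ≤
      (Real.exp (M / (1 - z / 2)) - 1) * ((1 + z / 2) / z) * ψ := by gcongr
  have h7 : (Real.exp (M / (1 - z / 2)) - 1) * ((1 + z / 2) / z) * ψ =
      (1 + z / 2) * ((Real.exp (M / (1 - z / 2)) - 1) / M) * (N * ψ) := by
    rw [← hNz]; field_simp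
  linarith

open Matrix in
/-- The one-step trace bound behind the matrix Chernoff inequality. -/
theorem Matrix.SpectrumIcc.trace_exp_add_le {ι : Type*} [Fintype ι] [DecidableEq ι]
    {A X : Matrix ι ι ℝ} {M : ℝ} (hM : 0 < M) (hA : A.IsHermitian) (hX : X.SpectrumIcc M) :
    trace (NormedSpace.exp (A + X)) ≤ trace (NormedSpace.exp A) +
      (Real.exp M - 1) / M * trace (X * NormedSpace.exp A) := by
  have hlim : Filter.Tendsto (fun N : ℕ => M / N) Filter.atTop (nhds 0) :=
    tendsto_const_div_atTop_nhds_zero_nat M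
  -- The N-step bound is a function of z = M/N that is continuous at 0, where it takes the desired
  -- value.
  have hc : ContinuousAt (fun z : ℝ => trace (NormedSpace.exp A) +
      (1 + z / 2) * ((Real.exp (M / (1 - z / 2)) - 1) / M) * trace (X * NormedSpace.exp A)) 0 := by
    have : (1 : ℝ) - 0 / 2 ≠ 0 := by norm_num
    fun_prop (disch := assumption)
  have h := hc.tendsto.comp hlim
  have e : trace (NormedSpace.exp A) +
      (Real.exp M - 1) / M * trace (X * NormedSpace.exp A) = trace (NormedSpace.exp A) +
      (1 + (0 : ℝ) / 2) * ((Real.exp (M / (1 - 0 / 2)) - 1) / M) *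
        trace (X * NormedSpace.exp A) := by simp
  rw [e]
  refine ge_of_tendsto h ?_
  filter_upwards [Filter.eventually_gt_atTop 0, hlim.eventually_lt_const (by norm_num : (0 : ℝ) < 2)]
    with N h1 h2
  exact hX.trace_exp_add_le_of_nat hM hA N h1 h2

open Matrix in
theorem Matrix.exp_add_smul_one {ι : Type*} [Fintype ι] [DecidableEq ι]
    (A : Matrix ι ι ℝ) (c : ℝ) :
    NormedSpace.exp (A + c • (1 : Matrix ι ι ℝ)) = Real.exp c • NormedSpace.exp A := by
  rw [Matrix.exp_add_of_commute _ _ ((Commute.one_right A).smul_right c), smul_one_eq_diagonal,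
    Matrix.exp_diagonal]
  have : NormedSpace.exp (fun _ : ι => c) = fun _ => Real.exp c := by
    funext i
    rw [Pi.coe_exp, Real.exp_eq_exp_ℝ]
  rw [this, ← smul_one_eq_diagonal, Matrix.mul_smul, Matrix.mul_one]

-- Write A - X = A + (M - X) - M, apply the additive bound to M - X, and pull out the scalar factor
-- e^{-M}.
open Matrix in
theorem Matrix.SpectrumIcc.trace_exp_sub_le {ι : Type*} [Fintype ι] [DecidableEq ι]
    {A X : Matrix ι ι ℝ} {M : ℝ} (hM : 0 < M) (hA : A.IsHermitian) (hX : X.SpectrumIcc M) :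
    trace (NormedSpace.exp (A - X)) ≤ trace (NormedSpace.exp A) -
      (1 - Real.exp (-M)) / M * trace (X * NormedSpace.exp A) := by
  have h := (hX.sub hM).trace_exp_add_le hM hA
  have e : A - X = A + (M • (1 : Matrix ι ι ℝ) - X) + (-M) • (1 : Matrix ι ι ℝ) := by
    rw [neg_smul]; abel
  rw [e, exp_add_smul_one, trace_smul, smul_eq_mul]
  have h2 := mul_le_mul_of_nonneg_left h (Real.exp_pos (-M)).le
  refine h2.trans_eq ?_
  have h3 : Real.exp (-M) * Real.exp M = 1 := by rw [← Real.exp_add]; simp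
  simp only [Matrix.sub_mul, trace_sub, Matrix.smul_mul, Matrix.one_mul, trace_smul, smul_eq_mul]
  field_simp
  linear_combination (trace (NormedSpace.exp A) * M - trace (X * NormedSpace.exp A)) * h3

open Matrix in
theorem Matrix.SpectrumIcc.trace_exp_add_smul_le {ι : Type*} [Fintype ι] [DecidableEq ι]
    {A X : Matrix ι ι ℝ} {M : ℝ} (hM : 0 < M) (hA : A.IsHermitian) (hX : X.SpectrumIcc M)
    (t : ℝ) :
    trace (NormedSpace.exp (A + t • X)) ≤ trace (NormedSpace.exp A) +
      (Real.exp (t * M) - 1) / M * trace (X * NormedSpace.exp A) := by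
  rcases lt_trichotomy t 0 with ht | rfl | ht
  · have h := (hX.smul (t := -t) (by linarith)).trace_exp_sub_le (mul_pos (by linarith) hM) hA
    rw [neg_smul, sub_neg_eq_add, neg_mul, neg_neg] at h
    refine h.trans_eq ?_
    rw [← neg_smul, Matrix.smul_mul, trace_smul, smul_eq_mul]
    have := ht.ne
    field_simp
    ring
  · simp
  · have h := (hX.smul (t := t) ht.le).trace_exp_add_le (mul_pos ht hM) hA
    refine h.trans_eq ?_
    rw [Matrix.smul_mul, trace_smul, smul_eq_mul]
    field_simp

/-! ### Exponential moments of sums of random rank-one matrices -/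

open Matrix in
theorem Matrix.trace_vecMulVec_mul_eq_sum {ι : Type*} [Fintype ι] (v : ι → ℝ)
    (C : Matrix ι ι ℝ) : trace (vecMulVec v v * C) = ∑ i, ∑ j, v i * v j * C j i := by
  simp [trace, mul_apply, vecMulVec_apply]

open Matrix in
theorem Matrix.continuous_exp_real {ι : Type*} [Fintype ι] [DecidableEq ι] :
    Continuous (NormedSpace.exp : Matrix ι ι ℝ → Matrix ι ι ℝ) := by
  let : NormedRing (Matrix ι ι ℝ) := Matrix.linftyOpNormedRing
  let : NormedAlgebra ℝ (Matrix ι ι ℝ) := Matrix.linftyOpNormedAlgebra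
  let : NormedAlgebra ℚ (Matrix ι ι ℝ) := NormedAlgebra.restrictScalars ℚ ℝ _
  exact NormedSpace.exp_continuous

open Matrix in
theorem Matrix.isHermitian_smul_vecMulVec {ι : Type*} [Fintype ι] [DecidableEq ι] (t : ℝ)
    (v : ι → ℝ) : (t • vecMulVec v v).IsHermitian := by
  have : (vecMulVec v v).IsHermitian := by
    simpa using (posSemidef_vecMulVec_self_star v).isHermitian
  unfold IsHermitian at *
  rw [conjTranspose_smul, this, star_trivial]

open Matrix in
/-- A random vector which is a.s. bounded and isotropic. -/
structure IsBoundedIsotropic {E ι : Type*} [Fintype ι] [DecidableEq ι] [MeasurableSpace E]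
    [TopologicalSpace E] (μ : Measure E) (v : E → ι → ℝ) (m : ℝ) : Prop where
  continuous : Continuous v
  bound : ∀ᵐ x ∂μ, v x ⬝ᵥ v x ≤ m
  integral_mul : ∀ i j, ∫ x, v x i * v x j ∂μ = (1 : Matrix ι ι ℝ) i j

open Matrix in
theorem IsBoundedIsotropic.continuous_trace_exp_sum {E ι : Type*} [Fintype ι] [DecidableEq ι]
    [MeasurableSpace E] [TopologicalSpace E] {μ : Measure E} {v : E → ι → ℝ} {m : ℝ}
    (hv : IsBoundedIsotropic μ v m) (t : ℝ)
    (H : Matrix ι ι ℝ) (n : ℕ) :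
    Continuous fun x : Fin n → E =>
      trace (NormedSpace.exp (H + ∑ i, t • vecMulVec (v (x i)) (v (x i)))) := by
  have hc := hv.continuous
  refine (continuous_exp_real.comp ?_).matrix_trace
  refine continuous_const.add (continuous_finsetSum _ fun i _ => ?_)
  have : Continuous fun x : Fin n → E => v (x i) := hc.comp (continuous_apply i)
  exact (this.matrix_vecMulVec this).const_smul t

section

variable {E ι : Type*} [Fintype ι] [DecidableEq ι] [MeasurableSpace E]
  [TopologicalSpace E] [BorelSpace E] {μ : Measure E}
  [IsProbabilityMeasure μ] {v : E → ι → ℝ} {m : ℝ}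

open Matrix

theorem IsBoundedIsotropic.integrable_mul (hv : IsBoundedIsotropic μ v m) (i j : ι) :
    Integrable (fun x => v x i * v x j) μ := by
  have hc := hv.continuous
  refine Integrable.of_bound (C := m) (by fun_prop) ?_
  filter_upwards [hv.bound] with x hx
  have hi : ∀ i, v x i * v x i ≤ m := fun i =>
    (Finset.single_le_sum (f := fun i => v x i * v x i) (fun k _ => mul_self_nonneg _)
      (Finset.mem_univ i)).trans hx
  rw [Real.norm_eq_abs, abs_le]
  constructor <;> nlinarith [hi i, hi j, sq_nonneg (v x i + v x j), sq_nonneg (v x i - v x j)]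

/-- Isotropy turns the mean of tr(v vᵀ exp H) into tr exp H, so the one-step bound averages to (1 +
c) tr exp H, and 1 + c ≤ e^c for c of either sign. -/
theorem IsBoundedIsotropic.lintegral_trace_exp_add_le (hm : 0 < m)
    (hv : IsBoundedIsotropic μ v m) (t : ℝ) {H : Matrix ι ι ℝ} (hH : H.IsHermitian) :
    ∫⁻ x, ENNReal.ofReal (trace (NormedSpace.exp (H + t • vecMulVec (v x) (v x)))) ∂μ ≤
      ENNReal.ofReal (Real.exp ((Real.exp (t * m) - 1) / m) * trace (NormedSpace.exp H)) := by
  set c := (Real.exp (t * m) - 1) / m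
  have hint : ∀ i j, Integrable (fun x => v x i * v x j * NormedSpace.exp H j i) μ := fun i j =>
    (hv.integrable_mul i j).mul_const _
  have hint2 : Integrable (fun x => trace (vecMulVec (v x) (v x) * NormedSpace.exp H)) μ := by
    simp only [trace_vecMulVec_mul_eq_sum]
    exact integrable_finsetSum _ fun i _ => integrable_finsetSum _ fun j _ => hint i j
  have hval : ∫ x, trace (vecMulVec (v x) (v x) * NormedSpace.exp H) ∂μ =
      trace (NormedSpace.exp H) := by
    simp only [trace_vecMulVec_mul_eq_sum]
    rw [integral_finsetSum _ fun i _ => integrable_finsetSum _ fun j _ => hint i j, trace]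
    refine Finset.sum_congr rfl fun i _ => ?_
    rw [integral_finsetSum _ fun j _ => hint i j]
    simp_rw [integral_mul_const, hv.integral_mul]
    rw [diag_apply, ← mul_apply, Matrix.one_mul]
  have hle : ∀ᵐ x ∂μ, trace (NormedSpace.exp (H + t • vecMulVec (v x) (v x))) ≤
      trace (NormedSpace.exp H) + c * trace (vecMulVec (v x) (v x) * NormedSpace.exp H) := by
    filter_upwards [hv.bound] with x hx
    exact (SpectrumIcc.vecMulVec hx).trace_exp_add_smul_le hm hH t
  have hnn : ∀ x, 0 ≤ trace (NormedSpace.exp (H + t • vecMulVec (v x) (v x))) := fun x =>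
    (hH.add (isHermitian_smul_vecMulVec t (v x))).exp_posSemidef.trace_nonneg
  calc _ ≤ ∫⁻ x, ENNReal.ofReal (trace (NormedSpace.exp H) +
        c * trace (vecMulVec (v x) (v x) * NormedSpace.exp H)) ∂μ := by
        refine lintegral_mono_ae ?_
        filter_upwards [hle] with x hx using ENNReal.ofReal_le_ofReal hx
    _ = ENNReal.ofReal (∫ x, (trace (NormedSpace.exp H) +
        c * trace (vecMulVec (v x) (v x) * NormedSpace.exp H)) ∂μ) := by
        refine (ofReal_integral_eq_lintegral_ofReal
          ((integrable_const _).add (hint2.const_mul c)) ?_).symm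
        filter_upwards [hle] with x hx using (hnn x).trans hx
    _ ≤ _ := by
        refine ENNReal.ofReal_le_ofReal ?_
        rw [integral_add (integrable_const _) (hint2.const_mul c), integral_const_mul, hval]
        simp only [integral_const, probReal_univ, one_smul]
        nlinarith [Real.add_one_le_exp c, hH.exp_posSemidef.trace_nonneg]

theorem IsBoundedIsotropic.lintegral_trace_exp_sum_le [SecondCountableTopology E] (hm : 0 < m)
    (hv : IsBoundedIsotropic μ v m) (t : ℝ) (n : ℕ) {H : Matrix ι ι ℝ} (hH : H.IsHermitian) :
    ∫⁻ x : Fin n → E, ENNReal.ofReal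
        (trace (NormedSpace.exp (H + ∑ i, t • vecMulVec (v (x i)) (v (x i)))))
        ∂(Measure.pi fun _ => μ) ≤
      ENNReal.ofReal (Real.exp (n * ((Real.exp (t * m) - 1) / m)) *
        trace (NormedSpace.exp H)) := by
  set c := (Real.exp (t * m) - 1) / m with hc
  -- `H` varies because the zeroth summand is absorbed into it: the induction hypothesis integrates
  -- out the other variables with that summand fixed, and the one-step bound then integrates it.
  induction n generalizing H with
  | zero => simp
  | succ n ih =>
    have hmp := measurePreserving_piFinSuccAbove (fun _ : Fin (n + 1) => μ) 0
    have hmeas := (hv.continuous_trace_exp_sum t H (n + 1)).measurable.ennreal_ofReal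
    rw [← (hmp.symm).lintegral_comp hmeas, lintegral_prod _ (by
      exact (hmeas.comp (MeasurableEquiv.measurable _)).aemeasurable)]
    have hsum : ∀ (x : E) (y : Fin n → E),
        H + ∑ i, t • vecMulVec (v ((MeasurableEquiv.piFinSuccAbove (fun _ => E) 0).symm (x, y) i))
          (v ((MeasurableEquiv.piFinSuccAbove (fun _ => E) 0).symm (x, y) i)) =
        (H + t • vecMulVec (v x) (v x)) + ∑ i, t • vecMulVec (v (y i)) (v (y i)) := by
      intro x y
      rw [Fin.sum_univ_succ, add_assoc]
      simp [MeasurableEquiv.piFinSuccAbove]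
    simp only [hsum]
    calc _ ≤ ∫⁻ x, ENNReal.ofReal (Real.exp (n * c)) *
          ENNReal.ofReal (trace (NormedSpace.exp (H + t • vecMulVec (v x) (v x)))) ∂μ := by
          refine lintegral_mono fun x => ?_
          rw [← ENNReal.ofReal_mul (Real.exp_pos _).le]
          exact ih (hH.add (isHermitian_smul_vecMulVec t (v x)))
      _ = ENNReal.ofReal (Real.exp (n * c)) * ∫⁻ x,
          ENNReal.ofReal (trace (NormedSpace.exp (H + t • vecMulVec (v x) (v x)))) ∂μ :=
          lintegral_const_mul' _ _ ENNReal.ofReal_ne_top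
      _ ≤ ENNReal.ofReal (Real.exp (n * c)) *
          ENNReal.ofReal (Real.exp c * trace (NormedSpace.exp H)) := by
          gcongr
          exact hv.lintegral_trace_exp_add_le hm t hH
      _ = _ := by
          rw [← ENNReal.ofReal_mul (Real.exp_pos _).le, ← mul_assoc, ← Real.exp_add]
          push_cast
          ring_nf

/-- Markov's inequality for the moment bound at H = 0, where the trace of exp 0 is the dimension. -/
theorem IsBoundedIsotropic.measure_trace_exp_sum_ge_le [SecondCountableTopology E] (hm : 0 < m)
    (hv : IsBoundedIsotropic μ v m) (t τ : ℝ) (n : ℕ) :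
    (Measure.pi fun _ => μ) {x : Fin n → E | Real.exp τ ≤
        trace (NormedSpace.exp (∑ i, t • vecMulVec (v (x i)) (v (x i))))} ≤
      ENNReal.ofReal (Fintype.card ι * Real.exp (n * ((Real.exp (t * m) - 1) / m) - τ)) := by
  have h := hv.lintegral_trace_exp_sum_le hm t n (H := 0) isHermitian_zero
  have hmeas := (hv.continuous_trace_exp_sum t 0 n).measurable.ennreal_ofReal
  have hM := mul_meas_ge_le_lintegral (μ := Measure.pi fun _ : Fin n => μ) hmeas
    (ENNReal.ofReal (Real.exp τ))
  simp only [zero_add, NormedSpace.exp_zero, trace_one] at h hM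
  have hs : {x : Fin n → E | Real.exp τ ≤
        trace (NormedSpace.exp (∑ i, t • vecMulVec (v (x i)) (v (x i))))} ⊆
      {x : Fin n → E | ENNReal.ofReal (Real.exp τ) ≤ ENNReal.ofReal
        (trace (NormedSpace.exp (∑ i, t • vecMulVec (v (x i)) (v (x i)))))} :=
    fun x hx => ENNReal.ofReal_le_ofReal hx
  refine (measure_mono hs).trans ?_
  have h0 : ENNReal.ofReal (Real.exp τ) ≠ 0 := by simp [Real.exp_pos]
  rw [mul_comm] at hM
  refine (ENNReal.le_div_iff_mul_le (Or.inl h0) (Or.inl ENNReal.ofReal_ne_top)).2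
    (hM.trans h) |>.trans_eq ?_
  rw [← ENNReal.ofReal_div_of_pos (Real.exp_pos τ), Real.exp_sub]
  congr 1
  ring

end

/-! ### Tail estimates and the matrix Chernoff inequality -/

-- The trace of exp A dominates each single e^{a_j}, so every eigenvalue is below τ.
open Matrix in
theorem Matrix.IsHermitian.dotProduct_mulVec_le_of_trace_exp_lt {ι : Type*} [Fintype ι]
    [DecidableEq ι] {A : Matrix ι ι ℝ} (hA : A.IsHermitian) {τ : ℝ}
    (h : trace (NormedSpace.exp A) < Real.exp τ) (q : ι → ℝ) :
    q ⬝ᵥ (A *ᵥ q) ≤ τ * (q ⬝ᵥ q) := by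
  obtain ⟨U, a, hU, hU', hAU, he⟩ := hA.exists_orthogonal_diagonalization
  have ha : ∀ j, a j ≤ τ := by
    intro j
    rw [he, trace_mul_comm, ← Matrix.mul_assoc, hU, Matrix.one_mul, trace_diagonal] at h
    exact (Real.exp_lt_exp.1 ((Finset.single_le_sum (f := fun i => Real.exp (a i))
      (fun i _ => (Real.exp_pos _).le) (Finset.mem_univ j)).trans_lt h)).le
  have e1 : q ⬝ᵥ q = (Uᵀ *ᵥ q) ⬝ᵥ (Uᵀ *ᵥ q) := by
    rw [dotProduct_mulVec, vecMul_mulVec, transpose_transpose, hU', vecMul_one]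
  have e2 : q ⬝ᵥ (A *ᵥ q) = (Uᵀ *ᵥ q) ⬝ᵥ (diagonal a *ᵥ (Uᵀ *ᵥ q)) := by
    have h := dotProduct_mulVec q U (diagonal a *ᵥ (Uᵀ *ᵥ q))
    rw [← mulVec_transpose] at h
    rw [← h, hAU]
    simp only [mulVec_mulVec, Matrix.mul_assoc]
  rw [e1, e2, dotProduct, dotProduct, Finset.mul_sum]
  refine Finset.sum_le_sum fun j _ => ?_
  rw [mulVec_diagonal]
  nlinarith [ha j, mul_self_nonneg ((Uᵀ *ᵥ q) j)]

/-- Bernstein's lower bound for the rate function of the Poisson law. -/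
theorem bernstein_le_mul_log {x : ℝ} (hx : 0 ≤ x) :
    3 * x ^ 2 / (6 + 2 * x) ≤ (1 + x) * Real.log (1 + x) - x := by
  -- Comparison of first derivatives. It follows in turn from that of second derivatives, 27/(3 +
  -- t)³ ≤ 1/(1 + t), which is clear on expanding the cube.
  have h1 : ∀ y : ℝ, 0 ≤ y → 3 / 2 - 27 / 2 / (3 + y) ^ 2 ≤ Real.log (1 + y) := by
    intro y hy
    have hd : ∀ t : ℝ, 0 ≤ t → HasDerivAt
        (fun t => Real.log (1 + t) - (3 / 2 - 27 / 2 / (3 + t) ^ 2))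
        (1 / (1 + t) - 27 / (3 + t) ^ 3) t := by
      intro t ht
      have e1 : HasDerivAt (fun t : ℝ => 1 + t) 1 t := (hasDerivAt_id t).const_add 1
      have e2 : HasDerivAt (fun t : ℝ => (3 + t) ^ 2) (2 * (3 + t)) t := by
        have := ((hasDerivAt_id t).const_add 3).pow 2
        refine this.congr_deriv ?_
        simp
      have h := (e1.log (by positivity)).sub
        ((((hasDerivAt_const t (27 / 2 : ℝ)).div e2 (by positivity))).const_sub (3 / 2))
      refine h.congr_deriv ?_
      field_simp
      ring
    have hm : MonotoneOn (fun t => Real.log (1 + t) - (3 / 2 - 27 / 2 / (3 + t) ^ 2))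
        (Set.Ici 0) := by
      refine monotoneOn_of_deriv_nonneg (convex_Ici 0)
        (fun t ht => (hd t ht).continuousAt.continuousWithinAt) ?_ ?_
      · intro t ht
        rw [interior_Ici] at ht
        exact (hd t (le_of_lt ht)).differentiableAt.differentiableWithinAt
      · intro t ht
        rw [interior_Ici] at ht
        have ht' : 0 ≤ t := le_of_lt ht
        rw [(hd t ht').deriv, sub_nonneg, div_le_div_iff₀ (by positivity) (by positivity)]
        nlinarith [pow_nonneg ht' 2, pow_nonneg ht' 3]
    have := hm (Set.mem_Ici.2 le_rfl) (Set.mem_Ici.2 hy) hy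
    norm_num at this
    linarith
  have hd : ∀ t : ℝ, 0 ≤ t → HasDerivAt
      (fun t => (1 + t) * Real.log (1 + t) - t - 3 * t ^ 2 / (6 + 2 * t))
      (Real.log (1 + t) - (3 / 2 - 27 / 2 / (3 + t) ^ 2)) t := by
    intro t ht
    have e1 : HasDerivAt (fun t : ℝ => 1 + t) 1 t := (hasDerivAt_id t).const_add 1
    have e2 : HasDerivAt (fun t : ℝ => 3 * t ^ 2) (3 * (2 * t)) t := by
      refine (((hasDerivAt_id t).pow 2).const_mul 3).congr_deriv ?_
      simp
    have e3 : HasDerivAt (fun t : ℝ => 6 + 2 * t) 2 t := by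
      refine (((hasDerivAt_id t).const_mul 2).const_add 6).congr_deriv ?_
      simp
    have h := ((e1.mul (e1.log (by positivity))).sub (hasDerivAt_id t)).sub
      (e2.div e3 (by positivity))
    refine h.congr_deriv ?_
    field_simp
    ring
  have hm : MonotoneOn (fun t => (1 + t) * Real.log (1 + t) - t - 3 * t ^ 2 / (6 + 2 * t))
      (Set.Ici 0) := by
    refine monotoneOn_of_deriv_nonneg (convex_Ici 0)
      (fun t ht => (hd t ht).continuousAt.continuousWithinAt) ?_ ?_
    · intro t ht
      rw [interior_Ici] at ht
      exact (hd t (le_of_lt ht)).differentiableAt.differentiableWithinAt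
    · intro t ht
      rw [interior_Ici] at ht
      rw [(hd t (le_of_lt ht)).deriv, sub_nonneg]
      exact h1 t (le_of_lt ht)
  have := hm (Set.mem_Ici.2 le_rfl) (Set.mem_Ici.2 hx) hx
  norm_num at this
  linarith

theorem exp_neg_le_quadratic {x : ℝ} (hx : 0 ≤ x) : Real.exp (-x) ≤ 1 - x + x ^ 2 / 2 := by
  have hd : ∀ t : ℝ, HasDerivAt (fun t : ℝ => 1 - t + t ^ 2 / 2 - Real.exp (-t))
      (-1 + t + Real.exp (-t)) t := by
    intro t
    have h := ((((hasDerivAt_id t).const_sub 1).add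
      (((hasDerivAt_id t).pow 2).div_const 2))).sub (hasDerivAt_neg t).exp
    refine h.congr_deriv ?_
    simp
  have hm : Monotone (fun t : ℝ => 1 - t + t ^ 2 / 2 - Real.exp (-t)) := by
    refine monotone_of_deriv_nonneg (fun t => (hd t).differentiableAt) fun t => ?_
    rw [(hd t).deriv]
    linarith [Real.add_one_le_exp (-t)]
  have := hm hx
  simp at this
  linarith

open Matrix in
theorem Matrix.dotProduct_sum_smul_vecMulVec_mulVec {ι κ : Type*} [Fintype ι] [Fintype κ] (t : ℝ)
    (w : κ → ι → ℝ) (q : ι → ℝ) :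
    q ⬝ᵥ ((∑ i, t • vecMulVec (w i) (w i)) *ᵥ q) = t * ∑ i, (q ⬝ᵥ w i) ^ 2 := by
  rw [sum_mulVec, dotProduct_sum, Finset.mul_sum]
  refine Finset.sum_congr rfl fun i _ => ?_
  rw [smul_mulVec, dotProduct_smul, vecMulVec_mulVec]
  simp only [dotProduct_comm (w i) q, dotProduct_smul, smul_eq_mul, op_smul_eq_smul]
  ring

open Matrix in
/-- A matrix Chernoff inequality for sums of independent rank-one matrices. -/
theorem IsBoundedIsotropic.measure_abs_sum_sq_sub_gt_le {E ι : Type*} [Fintype ι] [DecidableEq ι]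
    [MeasurableSpace E] [TopologicalSpace E] [BorelSpace E] [SecondCountableTopology E]
    {μ : Measure E} [IsProbabilityMeasure μ] {v : E → ι → ℝ} {m : ℝ} (hm : 0 < m)
    (hv : IsBoundedIsotropic μ v m) {n : ℕ} (hn : 0 < n) {u : ℝ} (hu : 0 < u) :
    (Measure.pi fun _ => μ) {x : Fin n → E | ∃ q : ι → ℝ, max (Real.sqrt u) u * (n * (q ⬝ᵥ q)) <
        |∑ i, (q ⬝ᵥ v (x i)) ^ 2 - n * (q ⬝ᵥ q)|} ≤
      ENNReal.ofReal (2 * (Fintype.card ι * Real.exp (-(3 * n * u / (8 * m))))) := by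
  have hn' : (0 : ℝ) < n := by exact_mod_cast hn
  set ε := max (Real.sqrt u) u with hε
  have hε0 : 0 < ε := hu.trans_le (le_max_right _ _)
  have hsq : u ≤ ε ^ 2 := by
    calc u = Real.sqrt u ^ 2 := (Real.sq_sqrt hu.le).symm
      _ ≤ ε ^ 2 := by gcongr; exact le_max_left _ _
  -- For ε ≤ 1 the denominator is at most 8 and u ≤ ε²; for ε ≥ 1 it is at most 8ε and u ≤ ε. This
  -- is why ε is the maximum of √u and u.
  have hrate : 3 / 8 * u ≤ 3 * ε ^ 2 / (6 + 2 * ε) := by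
    rw [le_div_iff₀ (by positivity)]
    rcases le_total ε 1 with h | h
    · nlinarith
    · have hue : u ≤ ε := le_max_right _ _
      nlinarith
  -- Minimizer of n (e^{θm} - 1)/m - θ n (1 + ε), the exponent in the upper tail.
  set θ := Real.log (1 + ε) / m with hθ
  have hlog : 0 < Real.log (1 + ε) := Real.log_pos (by linarith)
  have hθ0 : 0 < θ := div_pos hlog hm
  have hθm : θ * m = Real.log (1 + ε) := by rw [hθ]; field_simp
  set B₁ : Set (Fin n → E) := {x | Real.exp (θ * (n * (1 + ε))) ≤
    trace (NormedSpace.exp (∑ i, θ • vecMulVec (v (x i)) (v (x i))))} with hB₁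
  -- The lower tail matters only for ε < 1, since the form is nonnegative. The parameter -ε/m is not
  -- optimal, but it gives the exponent -(n/m) ε²/2, which suffices.
  set B₂ : Set (Fin n → E) := {x | ε < 1 ∧ Real.exp ((-(ε / m)) * (n * (1 - ε))) ≤
    trace (NormedSpace.exp (∑ i, (-(ε / m)) • vecMulVec (v (x i)) (v (x i))))} with hB₂
  have hsub : {x : Fin n → E | ∃ q : ι → ℝ, ε * (n * (q ⬝ᵥ q)) <
      |∑ i, (q ⬝ᵥ v (x i)) ^ 2 - n * (q ⬝ᵥ q)|} ⊆ B₁ ∪ B₂ := by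
    rintro x ⟨q, hq⟩
    by_contra hx
    rw [Set.mem_union, not_or] at hx
    obtain ⟨h1, h2⟩ := hx
    have hH : ∀ t : ℝ, (∑ i, t • vecMulVec (v (x i)) (v (x i))).IsHermitian := fun t =>
      isSelfAdjoint_sum _ fun i _ => isHermitian_smul_vecMulVec t (v (x i))
    have hq0 : 0 ≤ q ⬝ᵥ q := Finset.sum_nonneg fun i _ => mul_self_nonneg _
    have hS0 : 0 ≤ ∑ i, (q ⬝ᵥ v (x i)) ^ 2 := Finset.sum_nonneg fun i _ => sq_nonneg _
    have hup : ∑ i, (q ⬝ᵥ v (x i)) ^ 2 ≤ n * (1 + ε) * (q ⬝ᵥ q) := by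
      have h := (hH θ).dotProduct_mulVec_le_of_trace_exp_lt (not_le.1 h1) q
      rw [dotProduct_sum_smul_vecMulVec_mulVec, mul_assoc] at h
      exact le_of_mul_le_mul_left h hθ0
    have hlow : n * (1 - ε) * (q ⬝ᵥ q) ≤ ∑ i, (q ⬝ᵥ v (x i)) ^ 2 := by
      rcases lt_or_ge ε 1 with hε1 | hε1
      · have h2' := not_le.1 fun h => h2 ⟨hε1, h⟩
        have h := (hH _).dotProduct_mulVec_le_of_trace_exp_lt h2' q
        rw [dotProduct_sum_smul_vecMulVec_mulVec, mul_assoc, neg_mul, neg_mul,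
          neg_le_neg_iff] at h
        exact le_of_mul_le_mul_left h (div_pos hε0 hm)
      · refine le_trans ?_ hS0
        exact mul_nonpos_of_nonpos_of_nonneg
          (mul_nonpos_of_nonneg_of_nonpos hn'.le (by linarith)) hq0
    have : |∑ i, (q ⬝ᵥ v (x i)) ^ 2 - n * (q ⬝ᵥ q)| ≤ ε * (n * (q ⬝ᵥ q)) := by
      rw [abs_le]
      constructor <;> linarith
    linarith
  set b := ENNReal.ofReal (Fintype.card ι * Real.exp (-(3 * n * u / (8 * m)))) with hb
  have hnm : 0 < n / m := div_pos hn' hm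
  have e0 : -(3 * n * u / (8 * m)) = n / m * (-(3 / 8 * u)) := by field_simp
  have hP1 : (Measure.pi fun _ => μ) B₁ ≤ b := by
    refine (hv.measure_trace_exp_sum_ge_le hm θ (θ * (n * (1 + ε))) n).trans ?_
    refine ENNReal.ofReal_le_ofReal ?_
    gcongr
    rw [hθm, Real.exp_log (by linarith), e0,
      show n * ((1 + ε - 1) / m) - θ * (n * (1 + ε)) =
        n / m * (ε - (1 + ε) * Real.log (1 + ε)) by rw [hθ]; field_simp; ring]
    refine mul_le_mul_of_nonneg_left ?_ hnm.le
    linarith [bernstein_le_mul_log hε0.le]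
  have hP2 : (Measure.pi fun _ => μ) B₂ ≤ b := by
    by_cases hε1 : ε < 1
    · simp only [hB₂, hε1, true_and]
      refine (hv.measure_trace_exp_sum_ge_le hm (-(ε / m)) _ n).trans ?_
      refine ENNReal.ofReal_le_ofReal ?_
      gcongr
      rw [show -(ε / m) * m = -ε by field_simp, e0,
        show n * ((Real.exp (-ε) - 1) / m) - -(ε / m) * (n * (1 - ε)) =
          n / m * (Real.exp (-ε) - 1 + ε * (1 - ε)) by field_simp; ring]
      refine mul_le_mul_of_nonneg_left ?_ hnm.le
      nlinarith [exp_neg_le_quadratic hε0.le]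
    · simp [hB₂, hε1]
  calc _ ≤ (Measure.pi fun _ => μ) (B₁ ∪ B₂) := measure_mono hsub
    _ ≤ b + b := (measure_union_le _ _).trans (add_le_add hP1 hP2)
    _ = _ := by rw [hb, ← ENNReal.ofReal_add (by positivity) (by positivity), two_mul]

/-! ### Dimension count, orthonormal polynomials and the kernel -/

theorem MvPolynomial.finrank_restrictTotalDegree_le (p d : ℕ) :
    Module.finrank ℝ (PolyLE p d) ≤ (d + p).choose d := by
  have hb := MvPolynomial.basisRestrictSupport ℝ
    {m : Fin p →₀ ℕ | (m.sum fun _ e => e) ≤ d}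
  let f : {m : Fin p →₀ ℕ | (m.sum fun _ e => e) ≤ d} →
      (Finset.univ : Finset (Fin (p + 1))).finsuppAntidiag d := fun m =>
    -- The slack d - |m| becomes an extra coordinate, so that exponents of degree at most d in p
    -- variables become exponents of degree exactly d in p + 1 variables.
    ⟨Finsupp.cons (d - m.1.sum fun _ e => e) m.1, by
      have hm : (m.1.sum fun _ e => e) ≤ d := m.2
      rw [Finset.mem_finsuppAntidiag]
      refine ⟨?_, Finset.subset_univ _⟩
      rw [Fin.sum_univ_succ]
      rw [Finsupp.sum_fintype _ _ (fun _ => rfl)] at hm ⊢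
      simp only [Finsupp.cons_zero, Finsupp.cons_succ]
      omega⟩
  have hf : Function.Injective f := by
    intro m m' h
    have h' := congrArg Finsupp.tail (congrArg Subtype.val h)
    simp only [f, Finsupp.tail_cons] at h'
    exact Subtype.ext h'
  have h1 := Nat.card_le_card_of_injective f hf
  rw [← Module.finrank_eq_nat_card_basis hb] at h1
  refine h1.trans_eq ?_
  rw [Nat.card_eq_fintype_card, Fintype.card_coe, Finset.card_finsuppAntidiag_nat_eq_choose]
  simp only [Finset.card_univ, Fintype.card_fin]
  congr 1
  omega

theorem integrable_eval_of_isCompact_support {p : ℕ} {μ : Measure (Fin p → ℝ)}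
    [IsFiniteMeasure μ] (hcomp : IsCompact μ.support) (P : MvPolynomial (Fin p) ℝ) :
    Integrable (fun y => MvPolynomial.eval y P) μ := by
  have hc : Continuous fun y : Fin p → ℝ => MvPolynomial.eval y P := MvPolynomial.continuous_eval P
  obtain ⟨C, hC⟩ := (hcomp.image hc).isBounded.exists_norm_le
  refine Integrable.of_bound hc.aestronglyMeasurable C ?_
  filter_upwards [Measure.support_mem_ae (μ := μ)] with x hx
  exact hC _ ⟨x, hx, rfl⟩

/-- Existence of orthonormal polynomials. -/
theorem exists_orthonormal_polynomials {p d : ℕ} {μ : Measure (Fin p → ℝ)}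
    (hI : ∀ P : MvPolynomial (Fin p) ℝ, Integrable (fun y => MvPolynomial.eval y P) μ)
    (hK : ∃ K, IsCDKernel μ d K) :
    ∃ e : Fin (Module.finrank ℝ (PolyLE p d)) → MvPolynomial (Fin p) ℝ,
      (∀ i, e i ∈ PolyLE p d) ∧
      (∀ i j, ∫ y, MvPolynomial.eval y (e i) * MvPolynomial.eval y (e j) ∂μ =
        if i = j then 1 else 0) ∧
      ∀ P ∈ PolyLE p d, ∃ q : Fin (Module.finrank ℝ (PolyLE p d)) → ℝ, P = ∑ i, q i • e i := by
  obtain ⟨K, hK⟩ := hK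
  have hI2 : ∀ P Q : MvPolynomial (Fin p) ℝ,
      Integrable (fun y => MvPolynomial.eval y P * MvPolynomial.eval y Q) μ := fun P Q => by
    simpa using hI (P * Q)
  let core : InnerProductSpace.Core ℝ (PolyLE p d) :=
    { inner := fun P Q => ∫ y, MvPolynomial.eval y P.1 * MvPolynomial.eval y Q.1 ∂μ
      conj_inner_symm := fun P Q => by simp [mul_comm]
      re_inner_nonneg := fun P => integral_nonneg fun y => mul_self_nonneg _
      add_left := fun P Q R => by
        rw [← integral_add (hI2 _ _) (hI2 _ _)]
        simp [add_mul]
      smul_left := fun P Q c => by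
        rw [← integral_const_mul]
        simp [mul_assoc]
      definite := fun P hP => by
        have hP' : ∫ y, MvPolynomial.eval y P.1 * MvPolynomial.eval y P.1 ∂μ = 0 := hP
        rw [integral_eq_zero_iff_of_nonneg (fun y => mul_self_nonneg _) (hI2 _ _)] at hP'
        refine Subtype.ext (MvPolynomial.funext fun x => ?_)
        -- Definiteness comes from the kernel: a polynomial vanishing μ-almost everywhere has zero
        -- integral against it, hence vanishes at every point.
        rw [← hK.reproducing x P.1 P.2]
        simp only [ZeroMemClass.coe_zero, map_zero]
        refine integral_eq_zero_of_ae ?_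
        filter_upwards [hP'] with y hy
        have : MvPolynomial.eval y P.1 = 0 := mul_self_eq_zero.1 hy
        simp [this] }
  let _ : NormedAddCommGroup (PolyLE p d) := core.toNormedAddCommGroup
  let _ : InnerProductSpace ℝ (PolyLE p d) := InnerProductSpace.ofCore core.toCore
  let b := stdOrthonormalBasis ℝ (PolyLE p d)
  refine ⟨fun i => (b i).1, fun i => (b i).2, fun i j => ?_, fun P hP => ?_⟩
  · exact orthonormal_iff_ite.1 b.orthonormal i j
  · refine ⟨fun i => b.repr ⟨P, hP⟩ i, ?_⟩
    have h := congrArg Subtype.val (b.sum_repr ⟨P, hP⟩)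
    simpa using h.symm

/-- The Christoffel–Darboux kernel in terms of orthonormal polynomials. -/
theorem isCDKernel_sum {p d : ℕ} {ι : Type*} [Fintype ι] [DecidableEq ι]
    {μ : Measure (Fin p → ℝ)}
    (hI : ∀ P : MvPolynomial (Fin p) ℝ, Integrable (fun y => MvPolynomial.eval y P) μ)
    {e : ι → MvPolynomial (Fin p) ℝ} (he : ∀ i, e i ∈ PolyLE p d)
    (hortho : ∀ i j, ∫ y, MvPolynomial.eval y (e i) * MvPolynomial.eval y (e j) ∂μ =
      if i = j then 1 else 0)
    (hspan : ∀ P ∈ PolyLE p d, ∃ q : ι → ℝ, P = ∑ i, q i • e i) :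
    IsCDKernel μ d fun x y => ∑ i, MvPolynomial.eval x (e i) * MvPolynomial.eval y (e i) := by
  refine ⟨fun x => ⟨∑ i, MvPolynomial.eval x (e i) • e i,
    Submodule.sum_mem _ fun i _ => Submodule.smul_mem _ _ (he i), fun y => by simp⟩, ?_⟩
  intro x P hP
  obtain ⟨q, rfl⟩ := hspan P hP
  have hI2 : ∀ P Q : MvPolynomial (Fin p) ℝ,
      Integrable (fun y => MvPolynomial.eval y P * MvPolynomial.eval y Q) μ := fun P Q => by
    simpa using hI (P * Q)
  have h : ∀ i, ∫ y, MvPolynomial.eval y (∑ i, q i • e i) * MvPolynomial.eval y (e i) ∂μ =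
      q i := by
    intro i
    have : ∀ y, MvPolynomial.eval y (∑ j, q j • e j) * MvPolynomial.eval y (e i) =
        ∑ j, q j * (MvPolynomial.eval y (e j) * MvPolynomial.eval y (e i)) := by
      intro y
      simp [Finset.sum_mul, mul_assoc]
    simp only [this]
    rw [integral_finsetSum _ fun j _ => (hI2 _ _).const_mul _]
    simp [integral_const_mul, hortho]
  have hy : ∀ y, MvPolynomial.eval y (∑ i, q i • e i) *
      ∑ i, MvPolynomial.eval x (e i) * MvPolynomial.eval y (e i) =
      ∑ i, MvPolynomial.eval x (e i) *
        (MvPolynomial.eval y (∑ i, q i • e i) * MvPolynomial.eval y (e i)) := by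
    intro y
    rw [Finset.mul_sum]
    exact Finset.sum_congr rfl fun i _ => by ring
  simp only [hy]
  rw [integral_finsetSum _ fun j _ => (hI2 _ _).const_mul _]
  simp only [integral_const_mul, h]
  simp [mul_comm]

/-! ### Comparison of Christoffel functions -/

theorem christoffel_eq_sInf_of_integrable {p d : ℕ} {μ : Measure (Fin p → ℝ)}
    (hI : ∀ P : MvPolynomial (Fin p) ℝ, Integrable (fun y => MvPolynomial.eval y P) μ)
    (z : Fin p → ℝ) :
    christoffel μ d z = sInf {r : ℝ | ∃ P ∈ PolyLE p d, MvPolynomial.eval z P = 1 ∧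
      r = ∫ y, (MvPolynomial.eval y P) ^ 2 ∂μ} := by
  by_cases h : ∃ K, IsCDKernel μ d K
  · exact christoffel_eq_sInf hI h z
  · rw [christoffel, if_neg h]

/-- Closeness of the quadratic forms entails closeness of the Christoffel functions. -/
theorem abs_christoffel_sub_le {p d : ℕ} {μ ν : Measure (Fin p → ℝ)}
    (hμ : ∀ P : MvPolynomial (Fin p) ℝ, Integrable (fun y => MvPolynomial.eval y P) μ)
    (hν : ∀ P : MvPolynomial (Fin p) ℝ, Integrable (fun y => MvPolynomial.eval y P) ν)
    {ε : ℝ} (hε : 0 ≤ ε)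
    (h : ∀ P ∈ PolyLE p d, |∫ y, (MvPolynomial.eval y P) ^ 2 ∂ν -
      ∫ y, (MvPolynomial.eval y P) ^ 2 ∂μ| ≤ ε * ∫ y, (MvPolynomial.eval y P) ^ 2 ∂μ)
    (z : Fin p → ℝ) :
    |christoffel μ d z - christoffel ν d z| ≤ christoffel μ d z * ε := by
  rw [christoffel_eq_sInf_of_integrable hμ, christoffel_eq_sInf_of_integrable hν]
  set S : Measure (Fin p → ℝ) → Set ℝ := fun ρ => {r : ℝ | ∃ P ∈ PolyLE p d,
    MvPolynomial.eval z P = 1 ∧ r = ∫ y, (MvPolynomial.eval y P) ^ 2 ∂ρ} with hS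
  have hone : (1 : MvPolynomial (Fin p) ℝ) ∈ PolyLE p d := by
    rw [MvPolynomial.mem_restrictTotalDegree]; simp
  have hne : ∀ ρ, (S ρ).Nonempty := fun ρ => ⟨_, 1, hone, by simp, rfl⟩
  have hnn : ∀ ρ, ∀ r ∈ S ρ, 0 ≤ r := by
    rintro ρ r ⟨P, -, -, rfl⟩
    exact integral_nonneg fun y => sq_nonneg _
  have hbd : ∀ ρ, BddBelow (S ρ) := fun ρ => ⟨0, hnn ρ⟩
  have h0 : ∀ ρ, 0 ≤ sInf (S ρ) := fun ρ => le_csInf (hne ρ) (hnn ρ)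
  change |sInf (S μ) - sInf (S ν)| ≤ sInf (S μ) * ε
  have hup : sInf (S ν) ≤ (1 + ε) * sInf (S μ) := by
    rw [← div_le_iff₀' (by linarith)]
    refine le_csInf (hne μ) ?_
    rintro r ⟨P, hP, hPz, rfl⟩
    rw [div_le_iff₀' (by linarith)]
    have h1 := (abs_le.1 (h P hP)).2
    have h2 := csInf_le (hbd ν) ⟨P, hP, hPz, rfl⟩
    linarith
  have hlow : (1 - ε) * sInf (S μ) ≤ sInf (S ν) := by
    -- For ε ≥ 1 the left side is nonpositive; otherwise multiplication by 1 - ε preserves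
    -- inequalities.
    rcases le_total ε 1 with h1 | h1
    · refine le_csInf (hne ν) ?_
      rintro r ⟨P, hP, hPz, rfl⟩
      have h2 := (abs_le.1 (h P hP)).1
      have h3 := mul_le_mul_of_nonneg_left (csInf_le (hbd μ) ⟨P, hP, hPz, rfl⟩)
        (sub_nonneg.2 h1)
      linarith
    · exact (mul_nonpos_of_nonpos_of_nonneg (by linarith) (h0 μ)).trans (h0 ν)
  rw [abs_le]
  constructor <;> linarith

theorem integrable_empiricalMeasure {p n : ℕ} (hn : 0 < n) (x : Fin n → Fin p → ℝ)
    (f : (Fin p → ℝ) → ℝ) : Integrable f (empiricalMeasure x) := by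
  refine Integrable.smul_measure ?_ (by simp [hn.ne'])
  rw [integrable_finsetSum_measure]
  exact fun i _ => integrable_dirac (by simp)

theorem integral_empiricalMeasure {p n : ℕ} (x : Fin n → Fin p → ℝ)
    (f : (Fin p → ℝ) → ℝ) :
    ∫ y, f y ∂(empiricalMeasure x) = (n : ℝ)⁻¹ * ∑ i, f (x i) := by
  rw [empiricalMeasure, integral_smul_measure, integral_finsetSum_measure]
  · simp
  · exact fun i _ => integrable_dirac (by simp)

theorem exists_eq_C_of_choose_eq_one {p d : ℕ} (h : (d + p).choose d = 1)
    {P : MvPolynomial (Fin p) ℝ} (hP : P ∈ PolyLE p d) : ∃ c, P = MvPolynomial.C c := by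
  rcases Nat.eq_zero_or_pos d with rfl | hd
  · rw [MvPolynomial.mem_restrictTotalDegree, Nat.le_zero] at hP
    exact ⟨_, MvPolynomial.totalDegree_eq_zero_iff_eq_C.1 hP⟩
  · rcases Nat.eq_zero_or_pos p with rfl | hp
    · exact ⟨_, MvPolynomial.eq_C_of_isEmpty P⟩
    · rw [Nat.choose_eq_one_iff] at h
      omega

/-! ### The high-probability event and the theorem -/

open Matrix in
/-- A high-probability comparison of the empirical and population quadratic forms. -/
theorem exists_event_abs_integral_sq_sub_le {p d : ℕ} {μ : Measure (Fin p → ℝ)}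
    [IsProbabilityMeasure μ]
    {ι : Type*} [Fintype ι] [DecidableEq ι] {e : ι → MvPolynomial (Fin p) ℝ} {m : ℝ} (hm : 0 < m)
    (hv : IsBoundedIsotropic μ (fun x i => MvPolynomial.eval x (e i)) m)
    (hspan : ∀ P ∈ PolyLE p d, ∃ q : ι → ℝ, P = ∑ i, q i • e i)
    {Ω : Type*} [MeasurableSpace Ω] {Pr : Measure Ω} [IsProbabilityMeasure Pr]
    {n : ℕ} (hn : 0 < n) {X : Fin n → Ω → Fin p → ℝ}
    (hindep : iIndepFun X Pr) (hlaw : ∀ i, HasLaw (X i) μ Pr) {u : ℝ} (hu : 0 < u) :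
    ∃ A : Set Ω, MeasurableSet A ∧
      1 - ENNReal.ofReal (2 * (Fintype.card ι * Real.exp (-(3 * n * u / (8 * m))))) ≤ Pr A ∧
      ∀ ω ∈ A, ∀ P ∈ PolyLE p d,
        |∫ y, (MvPolynomial.eval y P) ^ 2 ∂(empiricalMeasure fun i => X i ω) -
          ∫ y, (MvPolynomial.eval y P) ^ 2 ∂μ| ≤
        max (Real.sqrt u) u * ∫ y, (MvPolynomial.eval y P) ^ 2 ∂μ := by
  have hn' : (0 : ℝ) < n := by exact_mod_cast hn
  have hX : ∀ i, AEMeasurable (X i) Pr := fun i => (hlaw i).aemeasurable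
  have hmap : Pr.map (fun ω i => X i ω) = Measure.pi fun _ => μ := by
    rw [(iIndepFun_iff_map_fun_eq_pi_map hX).1 hindep]
    simp only [fun i => (hlaw i).map_eq]
  set Bad : Set (Fin n → Fin p → ℝ) := {x | ∃ q : ι → ℝ,
    max (Real.sqrt u) u * (n * (q ⬝ᵥ q)) <
      |∑ i, (q ⬝ᵥ fun j => MvPolynomial.eval (x i) (e j)) ^ 2 - n * (q ⬝ᵥ q)|} with hBad
  -- `Bad` is a union over uncountably many q and the `X i` are only almost everywhere measurable,
  -- so a measurable hull is taken both of `Bad` and of the preimage.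
  set T := toMeasurable (Measure.pi fun _ => μ) Bad
  have hT : Pr ((fun ω i => X i ω) ⁻¹' T) ≤
      ENNReal.ofReal (2 * (Fintype.card ι * Real.exp (-(3 * n * u / (8 * m))))) := by
    rw [← Measure.map_apply_of_aemeasurable (aemeasurable_pi_lambda _ hX)
      (measurableSet_toMeasurable _ _), hmap, measure_toMeasurable]
    exact hv.measure_abs_sum_sq_sub_gt_le hm hn hu
  refine ⟨(toMeasurable Pr ((fun ω i => X i ω) ⁻¹' T))ᶜ,
    (measurableSet_toMeasurable _ _).compl, ?_, ?_⟩
  · rw [prob_compl_eq_one_sub (measurableSet_toMeasurable _ _), measure_toMeasurable]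
    exact tsub_le_tsub_left hT 1
  · intro ω hω P hP
    have hω' : (fun i => X i ω) ∉ Bad := fun h =>
      hω (subset_toMeasurable _ _ (subset_toMeasurable _ _ h))
    obtain ⟨q, rfl⟩ := hspan P hP
    have heval : ∀ y, MvPolynomial.eval y (∑ i, q i • e i) =
        q ⬝ᵥ fun j => MvPolynomial.eval y (e j) := fun y => by
      simp [dotProduct]
    have hμ : ∫ y, (MvPolynomial.eval y (∑ i, q i • e i)) ^ 2 ∂μ = q ⬝ᵥ q := by
      have hy : ∀ y, (MvPolynomial.eval y (∑ i, q i • e i)) ^ 2 = ∑ i, ∑ j,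
          q i * q j * (MvPolynomial.eval y (e i) * MvPolynomial.eval y (e j)) := by
        intro y
        rw [heval, dotProduct, sq, Finset.sum_mul_sum]
        exact Finset.sum_congr rfl fun i _ => Finset.sum_congr rfl fun j _ => by ring
      have hi : ∀ i j, Integrable (fun y =>
          q i * q j * (MvPolynomial.eval y (e i) * MvPolynomial.eval y (e j))) μ :=
        fun i j => (hv.integrable_mul i j).const_mul _
      simp only [hy]
      rw [integral_finsetSum _ fun i _ => integrable_finsetSum _ fun j _ => hi i j]
      refine Finset.sum_congr rfl fun i _ => ?_
      rw [integral_finsetSum _ fun j _ => hi i j]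
      simp only [integral_const_mul, hv.integral_mul]
      simp [one_apply]
    have hb : |∑ i, (q ⬝ᵥ fun j => MvPolynomial.eval (X i ω) (e j)) ^ 2 - n * (q ⬝ᵥ q)| ≤
        max (Real.sqrt u) u * (n * (q ⬝ᵥ q)) := not_lt.1 fun h => hω' ⟨q, h⟩
    rw [integral_empiricalMeasure, hμ]
    simp only [heval]
    rw [show (n : ℝ)⁻¹ * ∑ i, (q ⬝ᵥ fun j => MvPolynomial.eval (X i ω) (e j)) ^ 2 - q ⬝ᵥ q =
      (n : ℝ)⁻¹ * (∑ i, (q ⬝ᵥ fun j => MvPolynomial.eval (X i ω) (e j)) ^ 2 - n * (q ⬝ᵥ q)) by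
        field_simp, abs_mul, abs_of_pos (inv_pos.2 hn')]
    calc _ ≤ (n : ℝ)⁻¹ * (max (Real.sqrt u) u * (n * (q ⬝ᵥ q))) := by gcongr
      _ = _ := by field_simp

theorem mainTheorem3 {p : ℕ} (d : ℕ)
    (μ : Measure (Fin p → ℝ)) [IsProbabilityMeasure μ]
    (hcomp : IsCompact μ.support) (hint : (interior μ.support).Nonempty)
    {Ω : Type*} [MeasurableSpace Ω] (Pr : Measure Ω) [IsProbabilityMeasure Pr]
    {n : ℕ} (hn : 0 < n) (X : Fin n → Ω → Fin p → ℝ)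
    (hindep : iIndepFun X Pr) (hlaw : ∀ i, HasLaw (X i) μ Pr)
    (m : ℝ) (hm : m = sSup ((fun x => cdKernel μ d x x) '' μ.support)) :
    BddAbove ((fun x => cdKernel μ d x x) '' μ.support) ∧
    ∀ α : ℝ, 0 < α →
      ∃ A : Set Ω, MeasurableSet A ∧ ENNReal.ofReal (1 - α) ≤ Pr A ∧
        ∀ ω ∈ A, ∀ x : Fin p → ℝ,
          |christoffel μ d x - christoffel (empiricalMeasure fun i => X i ω) d x| ≤
            christoffel μ d x *
              max (Real.sqrt (16 * m / (3 * n) * Real.log (((d + p).choose d : ℝ) / α)))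
                (16 * m / (3 * n) * Real.log (((d + p).choose d : ℝ) / α)) := by
  have hn' : (0 : ℝ) < n := by exact_mod_cast hn
  have hI := integrable_eval_of_isCompact_support hcomp
  have hν : ∀ ω, ∀ P : MvPolynomial (Fin p) ℝ, Integrable (fun y => MvPolynomial.eval y P)
      (empiricalMeasure fun i => X i ω) := fun ω P => integrable_empiricalMeasure hn _ _
  have hK := exists_isCDKernel d hcomp hint
  obtain ⟨e, he, hortho, hspan⟩ := exists_orthonormal_polynomials hI hK
  have hker : ∀ x, cdKernel μ d x x =
      ∑ i, MvPolynomial.eval x (e i) * MvPolynomial.eval x (e i) := fun x =>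
    congrFun (congrFun ((isCDKernel_cdKernel hK).unique (isCDKernel_sum hI he hortho hspan)) x) x
  have hbdd : BddAbove ((fun x => cdKernel μ d x x) '' μ.support) := by
    refine hcomp.bddAbove_image (Continuous.continuousOn ?_)
    simp only [hker]
    exact continuous_finsetSum _ fun i _ =>
      (MvPolynomial.continuous_eval (e i)).mul (MvPolynomial.continuous_eval (e i))
  refine ⟨hbdd, fun α hα => ?_⟩
  have hle : ∀ x ∈ μ.support,
      ∑ i, MvPolynomial.eval x (e i) * MvPolynomial.eval x (e i) ≤ m := fun x hx => by
    rw [hm, ← hker]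
    exact le_csSup hbdd ⟨x, hx, rfl⟩
  have hm0 : 0 < m := by
    obtain ⟨x, hx⟩ := hint
    refine lt_of_lt_of_le ?_ (hle x (interior_subset hx))
    -- If the diagonal vanished at x, every basis polynomial would vanish there, and so would the
    -- constant 1.
    refine lt_of_le_of_ne (Finset.sum_nonneg fun i _ => mul_self_nonneg _) fun h => ?_
    rw [eq_comm, Finset.sum_eq_zero_iff_of_nonneg fun i _ => mul_self_nonneg _] at h
    obtain ⟨q, hq⟩ := hspan 1 (by rw [MvPolynomial.mem_restrictTotalDegree]; simp)
    have h1 := congrArg (MvPolynomial.eval x) hq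
    have h2 : ∀ i, MvPolynomial.eval x (e i) = 0 := fun i =>
      mul_self_eq_zero.1 (h i (Finset.mem_univ i))
    simp [h2] at h1
  have hv : IsBoundedIsotropic μ (fun x i => MvPolynomial.eval x (e i)) m :=
    { continuous := continuous_pi fun i => MvPolynomial.continuous_eval (e i)
      bound := by
        filter_upwards [Measure.support_mem_ae (μ := μ)] with x hx using hle x hx
      integral_mul := fun i j => by rw [hortho, Matrix.one_apply] }
  set s : ℝ := ((d + p).choose d : ℝ) with hs
  set u : ℝ := 16 * m / (3 * n) * Real.log (s / α) with hu
  have hε : 0 ≤ max (Real.sqrt u) u := le_max_of_le_left (Real.sqrt_nonneg u)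
  have hchoose : 0 < (d + p).choose d := Nat.choose_pos (Nat.le_add_right d p)
  rcases le_or_gt 1 α with hα1 | hα1
  · exact ⟨∅, MeasurableSet.empty, by simp [ENNReal.ofReal_of_nonpos (sub_nonpos.2 hα1)],
      fun ω hω => absurd hω (Set.notMem_empty ω)⟩
  -- When s = 1 the factor 2 from the two tails cannot be absorbed, but then all polynomials are
  -- constant and both probability measures give the same form.
  by_cases hs1 : (d + p).choose d = 1
  · refine ⟨Set.univ, MeasurableSet.univ, ?_, fun ω _ x => ?_⟩
    · rw [measure_univ]
      exact ENNReal.ofReal_le_one.2 (by linarith)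
    · refine abs_christoffel_sub_le hI (hν ω) hε (fun P hP => ?_) x
      obtain ⟨c, rfl⟩ := exists_eq_C_of_choose_eq_one hs1 hP
      rw [integral_empiricalMeasure]
      simp only [MvPolynomial.eval_C, integral_const, probReal_univ, one_smul, Finset.sum_const,
        Finset.card_univ, Fintype.card_fin, nsmul_eq_mul]
      rw [inv_mul_cancel_left₀ hn'.ne', sub_self, abs_zero]
      positivity
  · have hs2 : (2 : ℝ) ≤ s := by
      rw [hs]; exact_mod_cast (by omega : 2 ≤ (d + p).choose d)
    have hsα : 1 < s / α := by rw [lt_div_iff₀ hα]; linarith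
    have hL := Real.log_pos hsα
    have hu0 : 0 < u := by positivity
    obtain ⟨A, hA, hPA, hAP⟩ := exists_event_abs_integral_sq_sub_le hm0 hv hspan hn hindep hlaw hu0
    refine ⟨A, hA, ?_, fun ω hω x => abs_christoffel_sub_le hI (hν ω) hε (hAP ω hω) x⟩
    refine le_trans ?_ hPA
    rw [ENNReal.ofReal_sub _ hα.le, ENNReal.ofReal_one]
    refine tsub_le_tsub_left (ENNReal.ofReal_le_ofReal ?_) 1
    have hcard : (Fintype.card (Fin (Module.finrank ℝ (PolyLE p d))) : ℝ) ≤ s := by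
      rw [Fintype.card_fin, hs]
      exact_mod_cast MvPolynomial.finrank_restrictTotalDegree_le p d
    -- The constant 16/3 in u makes the exponent -2 log(s/α). The failure probability is then at
    -- most 2α²/s, which is below α because α < 1 and s ≥ 2.
    have hexp : Real.exp (-(3 * n * u / (8 * m))) = (α / s) ^ 2 := by
      rw [show -(3 * n * u / (8 * m)) = 2 * -Real.log (s / α) by rw [hu]; field_simp; ring,
        ← Real.log_inv, inv_div, two_mul, Real.exp_add, Real.exp_log (by positivity), sq]
    rw [hexp]
    calc _ ≤ 2 * (s * (α / s) ^ 2) := by gcongr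
      _ = α * (2 * α / s) := by field_simp
      _ ≤ α * 1 := by
          gcongr
          rw [div_le_one (by linarith)]
          linarith
      _ = α := mul_one α
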